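/- Let $I=[0,1]$, let $n\ge 0$, let $P\colon\mathbb R^n\to\mathbb R$ be a nonzero real polynomial in $n$ variables, and put $V=P^{-1}(0)$. Let $W$ be a compact smooth manifold, possibly with boundary and corners. Give the space $C^\infty(I\times W,\mathbb R^n)$ of smooth maps the $C^\infty$-topology (uniform convergence of the coordinate expressions and of all their derivatives on compact subsets of smooth charts of $I\times W$), and for $G\in C^\infty(I\times W,\mathbb R^n)$ and $u\in W$ let $G_u\colon I\to\mathbb R^n$ be the map $G_u(t)=G(t,u)$. Then there is an open dense subset $\mathcal U$ of $C^\infty(I\times W,\mathbb R^n)$ such that for every $G\in\mathcal U$ and every $u\in W$ the set $G_u^{-1}(V)\subset I$ is finite. -/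

import Mathlib

open scoped Manifold ContDiff

/-- The `C^∞`-topology on the space of smooth maps from a manifold `M` (possibly with boundary and
corners) to a normed space `F`: uniform convergence, on compact subsets of the domain of every
smooth chart of `M`, of the coordinate expression and of all its iterated derivatives. -/
noncomputable instance ContMDiffMap.smoothTopology
    {E : Type*} [NormedAddCommGroup E] [NormedSpace ℝ E]
    {H : Type*} [TopologicalSpace H] {J : ModelWithCorners ℝ E H}
    {M : Type*} [TopologicalSpace M] [ChartedSpace H M]
    {F : Type*} [NormedAddCommGroup F] [NormedSpace ℝ F] :
    TopologicalSpace C^∞⟮J, M; 𝓘(ℝ, F), F⟯ :=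
  ⨅ φ ∈ IsManifold.maximalAtlas J ∞ M, ⨅ k : ℕ,
    TopologicalSpace.induced
      (fun G : C^∞⟮J, M; 𝓘(ℝ, F), F⟯ =>
        UniformOnFun.ofFun {K : Set E | IsCompact K ∧ K ⊆ (φ.extend J).target}
          (iteratedFDerivWithin ℝ k (G ∘ (φ.extend J).symm) (φ.extend J).target))
      inferInstance

/-- The zero set `P⁻¹(0)` in `ℝ^n` of a real polynomial `P` in `n` variables. -/
def polynomialZeroSet {n : ℕ} (P : MvPolynomial (Fin n) ℝ) : Set (EuclideanSpace ℝ (Fin n)) :=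
  {x | MvPolynomial.eval (fun i => x i) P = 0}

/-!
The good maps `G` are those for which no function `P ∘ G (·, u)` has a zero of infinite order
(`finiteOrderMaps`). Zeros of finite order are isolated by Taylor's theorem, so by compactness of
`[0, 1]` each `P ∘ G (·, u)` has finitely many zeros (`finite_zeros_of_iteratedDerivWithin_ne_zero`).
The Taylor coefficients in time of `P ∘ G (·, u)` are continuous in `(G, t, u)`, because the
`C^∞`-topology controls the derivatives in a product chart
(`continuous_iteratedDerivWithin_timeCurve`). As `[0, 1] × W` is compact, good maps form an open set.

Density replaces jet transversality by an elementary measure estimate. Choose a vector `e` at which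
the top-degree homogeneous part of `P` is nonzero, and perturb `G` to
`G + (∑ l, a l * t ^ l) • e`. With `D` the total degree of `P`, the Taylor coefficient of order
`k * D` of `P` along the perturbed curve is a polynomial of degree exactly `D`, with a fixed leading
coefficient `c`, in the `k`-th Taylor coefficient `b k` of the perturbing function
(`MvPolynomial.exists_coeff_aeval_powerSeries_eq_eval`); hence it is at most `|c| * η ^ D` in absolute
value only for a set of `b k` of measure at most `2 * D * η`
(`Polynomial.volume_abs_eval_le_le`). It involves only the `b j` with `j ≤ k * D`. So along a sequence
of orders `k` growing faster than by the factor `D` the conditions are triangular, and Fubini shows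
that `d` of them hold at once only for parameters of measure `O (η ^ d)`, uniformly in the unperturbed
curve (`MvPolynomial.measure_small_coeff_le`). Passing from the parameters `a` to the Taylor
coefficients `b` at a time `t` is a unipotent, hence volume-preserving, change of variables.

In a chart with compact convex domain `K` of dimension `m - 1`, divide `[0, 1] × K` into
`q ^ (D * m)` cells of size `O (q ^ (-D))`. If `P` has a zero of infinite order in some cell, the
controlled coefficients are `O (q ^ (-D))` at a chosen point of that cell, since they are Lipschitz; by
the estimate with `η = O (1 / q)` and `d = D * m + 1` this happens, for some cell, only for
parameters of measure `O (1 / q)`. Letting `q` grow, the bad parameters form a null set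
(`MvPolynomial.volume_flat_parameters_eq_zero`). Finitely many charts cover `W`, so good parameters
exist arbitrarily close to `0`.
-/

/-! ### Restricting a polynomial to lines in a fixed direction -/

/-- Over an infinite field the top-degree homogeneous part of a nonzero polynomial is nonzero at
some vector. -/
lemma MvPolynomial.exists_eval_homogeneousComponent_ne_zero {σ R : Type*} [Field R]
    [Infinite R] {P : MvPolynomial σ R} (hP : P ≠ 0) :
    ∃ e : σ → R, eval e (homogeneousComponent P.totalDegree P) ≠ 0 := by
  by_contra! h
  have h0 : homogeneousComponent P.totalDegree P = 0 := MvPolynomial.funext fun x => by simp [h x]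
  have hne : P.support.Nonempty := by
    simpa [Finset.nonempty_iff_ne_empty] using hP
  obtain ⟨m, hm, hm'⟩ := Finset.exists_mem_eq_sup P.support hne (fun m => m.sum fun _ e => e)
  have h1 := congrArg (coeff m) h0
  rw [coeff_homogeneousComponent, coeff_zero, if_pos] at h1
  · exact (mem_support_iff.1 hm) h1
  · rw [totalDegree, hm']
    simp [Finsupp.degree_apply, Finsupp.sum]

lemma Polynomial.natDegree_prod_pow_le_and_coeff {σ A : Type*} [CommRing A] (s : Finset σ)
    (m : σ → ℕ) (q : σ → Polynomial A) (a : σ → A)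
    (hq : ∀ j, (q j).natDegree ≤ 1) (ha : ∀ j, (q j).coeff 1 = a j) :
    (∏ j ∈ s, q j ^ m j).natDegree ≤ ∑ j ∈ s, m j ∧
      (∏ j ∈ s, q j ^ m j).coeff (∑ j ∈ s, m j) = ∏ j ∈ s, a j ^ m j := by
  classical
  induction s using Finset.induction_on with
  | empty => simp
  | insert j s hj ih =>
    have h1 : (q j ^ m j).natDegree ≤ m j := by
      simpa using Polynomial.natDegree_pow_le_of_le (m j) (hq j)
    have h2 : (q j ^ m j).coeff (m j) = a j ^ m j := by
      simpa [ha] using Polynomial.coeff_pow_of_natDegree_le (m := m j) (hq j)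
    rw [Finset.prod_insert hj, Finset.sum_insert hj, Finset.prod_insert hj]
    exact ⟨Polynomial.natDegree_mul_le_of_le h1 ih.1,
      by rw [Polynomial.coeff_mul_add_eq_of_natDegree_le h1 ih.1, h2, ih.2]⟩

/-- Along any line with direction `e`, over any algebra, `P` is a polynomial in one variable of
degree at most `P.totalDegree` whose coefficient in that degree is the value at `e` of the
top-degree homogeneous part of `P`; it does not depend on the base point of the line. -/
lemma MvPolynomial.natDegree_aeval_line_le_and_coeff {σ R A : Type*} [CommRing R] [CommRing A]
    [Algebra R A] (P : MvPolynomial σ R) (g : σ → A) (e : σ → R) :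
    (aeval (fun j => Polynomial.C (g j) + Polynomial.C (algebraMap R A (e j)) * Polynomial.X)
        P).natDegree ≤ P.totalDegree ∧
      (aeval (fun j => Polynomial.C (g j) + Polynomial.C (algebraMap R A (e j)) * Polynomial.X)
        P).coeff P.totalDegree =
        algebraMap R A (eval e (homogeneousComponent P.totalDegree P)) := by
  classical
  set q : σ → Polynomial A :=
    fun j => Polynomial.C (g j) + Polynomial.C (algebraMap R A (e j)) * Polynomial.X with hqdef
  have hq : ∀ j, (q j).natDegree ≤ 1 := fun j => by
    simp only [hqdef]; compute_degree
  have ha : ∀ j, (q j).coeff 1 = algebraMap R A (e j) := fun j => by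
    simp [hqdef, Polynomial.coeff_C]
  have key : ∀ m : σ →₀ ℕ, (m.prod fun j k => q j ^ k).natDegree ≤ m.degree ∧
      (m.prod fun j k => q j ^ k).coeff m.degree =
        m.prod fun j k => algebraMap R A (e j) ^ k := fun m =>
    Polynomial.natDegree_prod_pow_le_and_coeff m.support m q _ hq ha
  have hle : ∀ m ∈ P.support, m.degree ≤ P.totalDegree := fun m hm => by
    simpa [Finsupp.degree_apply, Finsupp.sum] using le_totalDegree hm
  have hP : aeval q P =
      ∑ m ∈ P.support, Polynomial.C (algebraMap R A (coeff m P)) * m.prod fun j k => q j ^ k := by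
    rw [aeval_def, eval₂_eq]; rfl
  rw [hP]
  constructor
  · refine Polynomial.natDegree_sum_le_of_forall_le _ _ fun m hm => ?_
    exact (Polynomial.natDegree_C_mul_le _ _).trans ((key m).1.trans (hle m hm))
  · rw [Polynomial.finsetSum_coeff, homogeneousComponent_apply, map_sum, map_sum,
      Finset.sum_filter]
    refine Finset.sum_congr rfl fun m hm => ?_
    rw [Polynomial.coeff_C_mul]
    split_ifs with h
    · rw [← h, (key m).2, eval_monomial, map_mul, Finsupp.prod, Finsupp.prod, map_prod]
      simp
    · rw [Polynomial.coeff_eq_zero_of_natDegree_lt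
        ((key m).1.trans_lt (lt_of_le_of_ne (hle m hm) h)), mul_zero]

/-! ### Coefficients of a polynomial evaluated at power series -/

open PowerSeries in
/-- The coefficient of `X ^ m` in `P(f)` depends only on the coefficients of `f` up to order `m`. -/
lemma MvPolynomial.coeff_aeval_powerSeries_congr {σ R : Type*} [CommRing R]
    (P : MvPolynomial σ R) {f g : σ → R⟦X⟧} {m : ℕ}
    (h : ∀ j, ∀ i ≤ m, PowerSeries.coeff i (f j) = PowerSeries.coeff i (g j)) :
    PowerSeries.coeff m (aeval f P) = PowerSeries.coeff m (aeval g P) := by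
  let I : Ideal R⟦X⟧ := Ideal.span {PowerSeries.X ^ (m + 1)}
  have hmk : ∀ u v : R⟦X⟧, Ideal.Quotient.mk I u = Ideal.Quotient.mk I v ↔
      ∀ i < m + 1, PowerSeries.coeff i u = PowerSeries.coeff i v := fun u v => by
    rw [Ideal.Quotient.eq, Ideal.mem_span_singleton, PowerSeries.X_pow_dvd_iff]
    simp [sub_eq_zero]
  refine (hmk _ _).1 ?_ m (Nat.lt_succ_self m)
  have hfg : (fun j => Ideal.Quotient.mk I (f j)) = fun j => Ideal.Quotient.mk I (g j) :=
    _root_.funext fun j => (hmk _ _).2 fun i hi => h j i (Nat.lt_succ_iff.1 hi)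
  rw [map_aeval, map_aeval, hfg]

open PowerSeries in
/-- If a power series `B` is perturbed to `B + b X ^ k`, the coefficient of order `k * D`,
`D = P.totalDegree`, of `P` evaluated at a series moving in the direction `e` is a polynomial of
degree at most `D` in `b`, and its coefficient of degree `D` does not depend on the series. -/
lemma MvPolynomial.exists_coeff_aeval_powerSeries_eq_eval {σ R : Type*} [CommRing R]
    (P : MvPolynomial σ R) (e : σ → R) (f : σ → R⟦X⟧) (B : R⟦X⟧) (k : ℕ) :
    ∃ p : Polynomial R, p.natDegree ≤ P.totalDegree ∧
      p.coeff P.totalDegree = eval e (homogeneousComponent P.totalDegree P) ∧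
      ∀ b : R, PowerSeries.coeff (k * P.totalDegree)
        (aeval (fun j => f j + (B + PowerSeries.C b * PowerSeries.X ^ k) * PowerSeries.C (e j)) P) =
          p.eval b := by
  set D := P.totalDegree with hD
  -- `Q` is `P` on the line through `f + B e` over the ring of power series, evaluated below at
  -- `b X ^ k`: only its top coefficient, a constant, contributes `b ^ D` in order `k * D`.
  obtain ⟨hdeg, hlead⟩ := P.natDegree_aeval_line_le_and_coeff (A := R⟦X⟧)
    (fun j => f j + B * PowerSeries.C (e j)) e
  set Q : Polynomial R⟦X⟧ := aeval (fun j => Polynomial.C (f j + B * PowerSeries.C (e j)) +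
    Polynomial.C (algebraMap R R⟦X⟧ (e j)) * Polynomial.X) P with hQ
  rw [← hD] at hdeg hlead
  refine ⟨∑ i ∈ Finset.range (D + 1), Polynomial.C
    (PowerSeries.coeff (k * D) (Q.coeff i * PowerSeries.X ^ (k * i))) * Polynomial.X ^ i,
    ?_, ?_, fun b => ?_⟩
  · refine Polynomial.natDegree_sum_le_of_forall_le _ _ fun i hi => ?_
    exact (Polynomial.natDegree_C_mul_X_pow_le _ _).trans (Nat.lt_succ_iff.1 (Finset.mem_range.1 hi))
  · simp only [Polynomial.finsetSum_coeff, Polynomial.coeff_C_mul_X_pow]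
    rw [Finset.sum_ite_eq, if_pos (Finset.self_mem_range_succ D), hlead,
      PowerSeries.algebraMap_apply, PowerSeries.coeff_C_mul, PowerSeries.coeff_X_pow_self, mul_one]
    rfl
  · have h1 : aeval (fun j => f j + (B + PowerSeries.C b * PowerSeries.X ^ k) *
        PowerSeries.C (e j)) P = Q.eval (PowerSeries.C b * PowerSeries.X ^ k) := by
      rw [← Polynomial.coe_evalRingHom, hQ, map_aeval, aeval_eq_eval₂Hom]
      congr 2
      · ext1 r
        simp [Polynomial.algebraMap_apply]
      · ext1 j
        simp only [Polynomial.coe_evalRingHom, Polynomial.eval_add, Polynomial.eval_C,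
          Polynomial.eval_mul, Polynomial.eval_X, PowerSeries.algebraMap_apply,
          Algebra.algebraMap_self, RingHom.id_apply]
        ring
    rw [h1, Polynomial.eval_eq_sum_range' (Nat.lt_succ_of_le hdeg), map_sum,
      Polynomial.eval_finsetSum]
    refine Finset.sum_congr rfl fun i _ => ?_
    rw [mul_pow, ← map_pow, ← pow_mul, mul_left_comm, PowerSeries.coeff_C_mul,
      Polynomial.eval_mul, Polynomial.eval_C, Polynomial.eval_pow, Polynomial.eval_X, mul_comm]

open MeasureTheory

/-! ### Sublevel sets of polynomials -/

/-- A real point at which a polynomial with leading coefficient `c` of degree `D` is at most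
`|c| * η ^ D` lies within `η` of one of its complex roots, hence of the real part of that root. -/
lemma Polynomial.volume_abs_eval_le_le (p : Polynomial ℝ) (hD : p.natDegree ≠ 0) {η : ℝ}
    (hη : 0 < η) :
    volume {x : ℝ | |p.eval x| ≤ |p.leadingCoeff| * η ^ p.natDegree} ≤
      ENNReal.ofReal (2 * p.natDegree * η) := by
  classical
  have hp : p ≠ 0 := by rintro rfl; simp at hD
  set q : Polynomial ℂ := p.map (algebraMap ℝ ℂ) with hq
  have hsplit : q.Splits := IsAlgClosed.splits q
  have hcard : q.roots.card = p.natDegree := by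
    rw [← hsplit.natDegree_eq_card_roots, hq, Polynomial.natDegree_map]
  -- Otherwise all factors of `p` over `ℂ` exceed `η` at `x`.
  have hsub : {x : ℝ | |p.eval x| ≤ |p.leadingCoeff| * η ^ p.natDegree} ⊆
      ⋃ r ∈ q.roots.toFinset, Metric.closedBall r.re η := by
    intro x hx
    by_contra hcon
    simp only [Set.mem_iUnion, Multiset.mem_toFinset, not_exists, Metric.mem_closedBall,
      not_le] at hcon
    have hlt : ∀ r ∈ q.roots, η < ‖(x : ℂ) - r‖ := fun r hr => by
      refine (hcon r hr).trans_le ?_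
      rw [Real.dist_eq]
      simpa using Complex.abs_re_le_norm ((x : ℂ) - r)
    have heval : |p.eval x| = |p.leadingCoeff| * (q.roots.map fun r => ‖(x : ℂ) - r‖).prod := by
      have h1 : (q.eval (x : ℂ)) = ((p.eval x : ℝ) : ℂ) := by
        rw [hq, ← Complex.coe_algebraMap, Polynomial.eval_map_algebraMap,
          Polynomial.aeval_algebraMap_apply]
        simp
      have h2 := congrArg norm h1
      rw [hsplit.eval_eq_prod_roots, norm_mul, Complex.norm_real, Real.norm_eq_abs] at h2
      rw [← h2]
      congr 1
      · simp [hq]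
      · have h3 := map_multiset_prod (normHom : ℂ →*₀ ℝ) (q.roots.map fun r => (x : ℂ) - r)
        rwa [Multiset.map_map] at h3
    have hpow : η ^ p.natDegree < (q.roots.map fun r => ‖(x : ℂ) - r‖).prod := by
      have hne : q.roots ≠ 0 := by
        rw [← Multiset.card_pos, hcard]; exact Nat.pos_of_ne_zero hD
      simpa [hcard] using Multiset.prod_map_lt_prod_map hne (fun _ => η) (fun r => ‖(x : ℂ) - r‖)
        (fun _ _ => hη) hlt
    rw [Set.mem_ofPred_eq, heval] at hx
    exact absurd hx (not_le.2 (mul_lt_mul_of_pos_left hpow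
      (abs_pos.2 (Polynomial.leadingCoeff_ne_zero.2 hp))))
  refine (measure_mono hsub).trans ((measure_biUnion_finset_le _ _).trans ?_)
  calc ∑ r ∈ q.roots.toFinset, volume (Metric.closedBall r.re η)
      = ∑ r ∈ q.roots.toFinset, ENNReal.ofReal (2 * η) := by simp [Real.volume_closedBall]
    _ = (q.roots.toFinset.card : ℕ) * ENNReal.ofReal (2 * η) := by simp
    _ ≤ (p.natDegree : ℕ) * ENNReal.ofReal (2 * η) := by
        gcongr
        exact (Multiset.toFinset_card_le _).trans hcard.le
    _ = ENNReal.ofReal (2 * p.natDegree * η) := by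
        rw [← ENNReal.ofReal_natCast, ← ENNReal.ofReal_mul (by positivity)]
        ring_nf

/-! ### Iterated sublevel estimates -/

/-- Fubini in the `i`-th coordinate: if membership in `T` does not depend on the `i`-th coordinate,
and `S ⊆ T` has sections in that coordinate of measure at most `M`, then cutting `T` down to `S`
costs a factor `M`. -/
lemma MeasureTheory.measure_pi_le_mul_of_update {ι : Type*} [Fintype ι] [DecidableEq ι]
    {X : ι → Type*} [∀ i, MeasurableSpace (X i)]
    (μ : ∀ i, Measure (X i)) [∀ i, SigmaFinite (μ i)] (i : ι) (hμ : 1 ≤ μ i Set.univ)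
    {S T : Set (∀ i, X i)} (hS : MeasurableSet S) (hT : MeasurableSet T) (hST : S ⊆ T)
    (hTi : ∀ x b, Function.update x i b ∈ T ↔ x ∈ T) {M : ENNReal}
    (hM : ∀ x, μ i {b | Function.update x i b ∈ S} ≤ M) :
    Measure.pi μ S ≤ M * Measure.pi μ T := by
  classical
  rw [← lintegral_indicator_one hS, ← lintegral_indicator_one hT,
    ← lintegral_const_mul _ (measurable_one.indicator hT)]
  refine lintegral_le_of_lmarginal_le {i} (measurable_one.indicator hS)
    ((measurable_one.indicator hT).const_mul M) fun x => ?_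
  rw [lmarginal_singleton, lmarginal_singleton]
  by_cases hx : x ∈ T
  · have h1 : ∀ b, (S.indicator 1 (Function.update x i b) : ENNReal) =
        ({b | Function.update x i b ∈ S} : Set (X i)).indicator 1 b := fun b => by
      simp [Set.indicator_apply]
    have h2 : ∀ b, M * (T.indicator 1 (Function.update x i b) : ENNReal) = M := fun b => by
      rw [Set.indicator_of_mem ((hTi x b).2 hx)]; simp
    simp only [h1, h2]
    rw [lintegral_indicator_one (show MeasurableSet {b | Function.update x i b ∈ S} from
      measurable_update x hS), lintegral_const]
    exact (hM x).trans (le_mul_of_one_le_right' hμ)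
  · have h1 : ∀ b, (S.indicator 1 (Function.update x i b) : ENNReal) = 0 := fun b =>
      Set.indicator_of_notMem (fun h => hx ((hTi x b).1 (hST h))) _
    simp [h1]

/-- The power series with coefficients `b`, followed by zeros. -/
noncomputable def PowerSeries.ofFin {N : ℕ} (b : Fin N → ℝ) : PowerSeries ℝ :=
  PowerSeries.mk fun i => if h : i < N then b ⟨i, h⟩ else 0

lemma PowerSeries.ofFin_update {N : ℕ} (b : Fin N → ℝ) (i : Fin N) (x : ℝ) :
    ofFin (Function.update b i x) =
      ofFin (Function.update b i 0) + C x * X ^ (i : ℕ) := by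
  ext m
  simp only [ofFin, map_add, coeff_mk, coeff_C_mul, coeff_X_pow, Function.update_apply, Fin.ext_iff]
  split_ifs <;> simp_all

/-- The indices `k` of the controlled parameters `b k`: each exceeds `D` times the one before, so
that the coefficient of order `D * k` of `P` does not involve the parameters at later indices. -/
def sparseOrder (D : ℕ) : ℕ → ℕ
  | 0 => 0
  | r + 1 => sparseOrder D r * D + 1

lemma sparseOrder_strictMono {D : ℕ} (hD : D ≠ 0) : StrictMono (sparseOrder D) :=
  strictMono_nat_of_lt_succ fun r => by
    have := Nat.le_mul_of_pos_right (sparseOrder D r) (Nat.pos_of_ne_zero hD)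
    simp only [sparseOrder]; omega

lemma sparseOrder_mul_lt {D : ℕ} (hD : D ≠ 0) {r s : ℕ} (h : r < s) :
    sparseOrder D r * D < sparseOrder D s :=
  (Nat.lt_succ_self _).trans_le ((sparseOrder_strictMono hD).monotone (Nat.succ_le_of_lt h))

open PowerSeries PowerSeries.WithPiTopology Filter Topology in
/-- Polynomials are continuous on tuples of power series, for coefficientwise convergence. -/
lemma MvPolynomial.tendsto_coeff_aeval_powerSeries {σ Y : Type*} (P : MvPolynomial σ ℝ)
    {l : Filter Y} {f : Y → σ → ℝ⟦X⟧} {g : σ → ℝ⟦X⟧}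
    (h : ∀ j i, Tendsto (fun y => PowerSeries.coeff i (f y j)) l (𝓝 (PowerSeries.coeff i (g j))))
    (m : ℕ) :
    Tendsto (fun y => PowerSeries.coeff m (aeval (f y) P)) l
      (𝓝 (PowerSeries.coeff m (aeval g P))) := by
  have hfg : Tendsto f l (𝓝 g) :=
    tendsto_pi_nhds.2 fun j => (tendsto_iff_coeff_tendsto _ _ _ _).2 (h j)
  have hc : Continuous fun Γ : σ → ℝ⟦X⟧ => aeval Γ P := by
    have : (fun Γ : σ → ℝ⟦X⟧ => aeval Γ P) =
        fun Γ => eval Γ (map (algebraMap ℝ ℝ⟦X⟧) P) := by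
      ext1 Γ; rw [eval_map, aeval_def]
    rw [this]
    exact MvPolynomial.continuous_eval _
  exact ((PowerSeries.WithPiTopology.continuous_coeff ℝ m).tendsto _).comp ((hc.tendsto g).comp hfg)

open PowerSeries in
lemma MvPolynomial.continuous_coeff_aeval_ofFin {n N : ℕ} (P : MvPolynomial (Fin n) ℝ)
    (e : Fin n → ℝ) (f : Fin n → ℝ⟦X⟧) (m : ℕ) :
    Continuous fun b : Fin N → ℝ =>
      PowerSeries.coeff m (aeval (fun j => f j + PowerSeries.ofFin b * PowerSeries.C (e j)) P) := by
  refine continuous_iff_continuousAt.2 fun b => P.tendsto_coeff_aeval_powerSeries (fun j i => ?_) m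
  simp only [map_add, PowerSeries.coeff_mul_C, PowerSeries.ofFin, PowerSeries.coeff_mk]
  refine Continuous.tendsto ?_ b
  split_ifs <;> fun_prop

open PowerSeries in
/-- The set of `b` for which the first `d` controlled coefficients of `P(f + b e)` are small has
measure at most `C η ^ d`, uniformly in the base series `f`. The order `sparseOrder D r * D`
coefficient involves only the coordinates of `b` below `sparseOrder D (r + 1)`, so that Fubini
applies once for each `r < d`. -/
lemma MvPolynomial.measure_small_coeff_le {n : ℕ} (P : MvPolynomial (Fin n) ℝ)
    (hD : P.totalDegree ≠ 0) (e : Fin n → ℝ)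
    (he : eval e (homogeneousComponent P.totalDegree P) ≠ 0) {N : ℕ}
    (μ : Fin N → Measure ℝ) [∀ i, SigmaFinite (μ i)] (hμ : ∀ i, 1 ≤ μ i Set.univ)
    (hμ' : ∀ i, μ i ≤ volume) (d : ℕ) (hd : sparseOrder P.totalDegree d ≤ N)
    (f : Fin n → ℝ⟦X⟧) {η : ℝ} (hη : 0 < η) :
    Measure.pi μ {b : Fin N → ℝ | ∀ r < d, |PowerSeries.coeff (sparseOrder P.totalDegree r *
        P.totalDegree) (aeval (fun j => f j + PowerSeries.ofFin b * PowerSeries.C (e j)) P)| ≤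
        |eval e (homogeneousComponent P.totalDegree P)| * η ^ P.totalDegree} ≤
      ENNReal.ofReal (2 * P.totalDegree * η) ^ d * Measure.pi μ Set.univ := by
  classical
  set D := P.totalDegree with hDdef
  set c := eval e (homogeneousComponent D P) with hc
  set F : ℕ → (Fin N → ℝ) → ℝ := fun r b => PowerSeries.coeff (sparseOrder D r * D)
    (aeval (fun j => f j + PowerSeries.ofFin b * PowerSeries.C (e j)) P) with hF
  have hmeas : ∀ d, MeasurableSet {b : Fin N → ℝ | ∀ r < d, |F r b| ≤ |c| * η ^ D} := fun d => by
    simp only [Set.ofPred_forall]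
    exact MeasurableSet.iInter fun r => MeasurableSet.iInter fun _ =>
      (isClosed_le (P.continuous_coeff_aeval_ofFin e f _).abs continuous_const).measurableSet
  change Measure.pi μ {b : Fin N → ℝ | ∀ r < d, |F r b| ≤ |c| * η ^ D} ≤ _
  induction d with
  | zero => simp
  | succ d ih =>
    have hlt : sparseOrder D d < N :=
      (sparseOrder_strictMono hD (Nat.lt_succ_self d)).trans_le hd
    set i : Fin N := ⟨sparseOrder D d, hlt⟩ with hi
    -- The earlier conditions do not involve the coordinate `i`.
    have hind : ∀ r < d, ∀ b x, F r (Function.update b i x) = F r b := fun r hr b x => by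
      refine P.coeff_aeval_powerSeries_congr fun j m hm => ?_
      have hmi : m < sparseOrder D d := hm.trans_lt (sparseOrder_mul_lt hD hr)
      have hBm : ∀ l ≤ m, PowerSeries.coeff l (PowerSeries.ofFin (Function.update b i x)) =
          PowerSeries.coeff l (PowerSeries.ofFin b) := fun l hl => by
        simp only [PowerSeries.ofFin, PowerSeries.coeff_mk, Function.update_apply, Fin.ext_iff, hi]
        split_ifs <;> first | rfl | omega
      rw [map_add, map_add, PowerSeries.coeff_mul_C, PowerSeries.coeff_mul_C, hBm m le_rfl]
    refine (measure_pi_le_mul_of_update μ i (hμ i) (hmeas (d + 1)) (hmeas d)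
      (fun b hb r hr => hb r (hr.trans (Nat.lt_succ_self d))) (fun b x => ?_)
      (M := ENNReal.ofReal (2 * D * η)) fun b => ?_).trans ?_
    · exact forall₂_congr fun r hr => by rw [hind r hr]
    · obtain ⟨p, hpdeg, hplead, hp⟩ := P.exists_coeff_aeval_powerSeries_eq_eval e f
        (PowerSeries.ofFin (Function.update b i 0)) (sparseOrder D d)
      rw [← hDdef] at hpdeg hplead hp
      have hdeg : p.natDegree = D :=
        le_antisymm hpdeg (Polynomial.le_natDegree_of_ne_zero (by rwa [hplead]))
      have hl : p.leadingCoeff = c := by rw [Polynomial.leadingCoeff, hdeg, hplead]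
      have hvol := p.volume_abs_eval_le_le (by rwa [hdeg]) hη
      rw [hdeg, hl] at hvol
      refine (hμ' i _).trans ((measure_mono fun x hx => ?_).trans hvol)
      have h1 := hx d (Nat.lt_succ_self d)
      simp only [hF] at h1
      rw [PowerSeries.ofFin_update] at h1
      rwa [Set.mem_ofPred_eq, ← hp]
    · rw [pow_succ', mul_assoc (ENNReal.ofReal _)]
      exact mul_le_mul_right (ih ((sparseOrder_strictMono hD (Nat.lt_succ_self d)).le.trans hd)) _

/-! ### Taylor series as a ring homomorphism -/

section Taylor

variable {s : Set ℝ} {t : ℝ}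

/-- The Taylor series at `t` of a real function, with derivatives taken within `s`. -/
noncomputable def taylorSeriesWithin (f : ℝ → ℝ) (s : Set ℝ) (t : ℝ) : PowerSeries ℝ :=
  PowerSeries.mk fun k => iteratedDerivWithin k f s t / k.factorial

lemma coeff_taylorSeriesWithin (f : ℝ → ℝ) (s : Set ℝ) (t : ℝ) (k : ℕ) :
    PowerSeries.coeff k (taylorSeriesWithin f s t) = iteratedDerivWithin k f s t / k.factorial :=
  PowerSeries.coeff_mk _ _

lemma taylorSeriesWithin_const (s : Set ℝ) (t c : ℝ) :
    taylorSeriesWithin (fun _ => c) s t = PowerSeries.C c := by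
  ext k
  rw [coeff_taylorSeriesWithin, PowerSeries.coeff_C, iteratedDerivWithin_const]
  split_ifs with h <;> simp [h]

lemma taylorSeriesWithin_add (hs : UniqueDiffOn ℝ s) (ht : t ∈ s) {f g : ℝ → ℝ}
    (hf : ContDiffOn ℝ ∞ f s) (hg : ContDiffOn ℝ ∞ g s) :
    taylorSeriesWithin (fun x => f x + g x) s t =
      taylorSeriesWithin f s t + taylorSeriesWithin g s t := by
  ext k
  have hk : ((k : ℕ) : WithTop ℕ∞) ≤ ∞ := by exact_mod_cast le_top
  rw [map_add, coeff_taylorSeriesWithin, coeff_taylorSeriesWithin, coeff_taylorSeriesWithin,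
    iteratedDerivWithin_fun_add ht hs ((hf t ht).of_le hk) ((hg t ht).of_le hk), add_div]

lemma taylorSeriesWithin_mul (hs : UniqueDiffOn ℝ s) (ht : t ∈ s) {f g : ℝ → ℝ}
    (hf : ContDiffOn ℝ ∞ f s) (hg : ContDiffOn ℝ ∞ g s) :
    taylorSeriesWithin (fun x => f x * g x) s t =
      taylorSeriesWithin f s t * taylorSeriesWithin g s t := by
  ext k
  have hk : ((k : ℕ) : WithTop ℕ∞) ≤ ∞ := by exact_mod_cast le_top
  have hmul := iteratedDerivWithin_mul ht hs ((hf t ht).of_le hk) ((hg t ht).of_le hk)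
  rw [coeff_taylorSeriesWithin, PowerSeries.coeff_mul, show (fun x => f x * g x) = f * g from rfl,
    hmul, Finset.Nat.sum_antidiagonal_eq_sum_range_succ_mk, Finset.sum_div]
  refine Finset.sum_congr rfl fun i hi => ?_
  have hi' : i ≤ k := Nat.lt_succ_iff.1 (Finset.mem_range.1 hi)
  rw [coeff_taylorSeriesWithin, coeff_taylorSeriesWithin, Nat.cast_choose ℝ hi']
  have h1 := Nat.cast_ne_zero (R := ℝ).2 (Nat.factorial_ne_zero k)
  have h2 := Nat.cast_ne_zero (R := ℝ).2 (Nat.factorial_ne_zero i)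
  have h3 := Nat.cast_ne_zero (R := ℝ).2 (Nat.factorial_ne_zero (k - i))
  field_simp

lemma ContDiffOn.mvPolynomial_eval {σ E : Type*} [NormedAddCommGroup E] [NormedSpace ℝ E]
    {s : Set E} {c : σ → E → ℝ} (hc : ∀ j, ContDiffOn ℝ ∞ (c j) s) (P : MvPolynomial σ ℝ) :
    ContDiffOn ℝ ∞ (fun x => MvPolynomial.eval (fun j => c j x) P) s := by
  induction P using MvPolynomial.induction_on with
  | C a => simpa using contDiffOn_const
  | add p q hp hq => simpa using hp.add hq
  | mul_X p j hp => simpa using hp.mul (hc j)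

lemma taylorSeriesWithin_mvPolynomial_eval (hs : UniqueDiffOn ℝ s) (ht : t ∈ s) {σ : Type*}
    {c : σ → ℝ → ℝ} (hc : ∀ j, ContDiffOn ℝ ∞ (c j) s) (P : MvPolynomial σ ℝ) :
    taylorSeriesWithin (fun x => MvPolynomial.eval (fun j => c j x) P) s t =
      MvPolynomial.aeval (fun j => taylorSeriesWithin (c j) s t) P := by
  induction P using MvPolynomial.induction_on with
  | C a =>
    simp only [MvPolynomial.eval_C, taylorSeriesWithin_const, MvPolynomial.aeval_C]
    rfl
  | add p q hp hq =>
    simp only [map_add]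
    rw [taylorSeriesWithin_add hs ht (ContDiffOn.mvPolynomial_eval hc p)
      (ContDiffOn.mvPolynomial_eval hc q), hp, hq]
  | mul_X p j hp =>
    simp only [map_mul, MvPolynomial.eval_X, MvPolynomial.aeval_X]
    rw [taylorSeriesWithin_mul hs ht (ContDiffOn.mvPolynomial_eval hc p) (hc j), hp]

/-- The matrix re-expanding a polynomial of degree less than `N` in powers of `x - t`. -/
def taylorShift (N : ℕ) (t : ℝ) : Matrix (Fin N) (Fin N) ℝ :=
  Matrix.of fun j l => ((l : ℕ).choose j : ℝ) * t ^ ((l : ℕ) - j)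

lemma det_taylorShift (N : ℕ) (t : ℝ) : (taylorShift N t).det = 1 := by
  rw [Matrix.det_of_isUpperTriangular]
  · simp [taylorShift]
  · intro i j hij
    simp only [taylorShift, Matrix.of_apply]
    rw [Nat.choose_eq_zero_of_lt (by exact hij)]
    simp

lemma taylorSeriesWithin_sum_pow (hs : UniqueDiffOn ℝ s) (ht : t ∈ s) {N : ℕ} (a : Fin N → ℝ) :
    taylorSeriesWithin (fun x => ∑ l, a l * x ^ (l : ℕ)) s t =
      PowerSeries.ofFin (Matrix.mulVec (taylorShift N t) a) := by
  ext k
  have hpow : ∀ l : Fin N, iteratedDerivWithin k (fun x : ℝ => a l * x ^ (l : ℕ)) s t =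
      a l * (((l : ℕ).descFactorial k : ℝ) * t ^ ((l : ℕ) - k)) := fun l => by
    rw [iteratedDerivWithin_const_mul_field, iteratedDerivWithin_pow ht hs]
  have hsum : iteratedDerivWithin k (fun x => ∑ l, a l * x ^ (l : ℕ)) s t =
      ∑ l, a l * (((l : ℕ).descFactorial k : ℝ) * t ^ ((l : ℕ) - k)) := by
    rw [iteratedDerivWithin_fun_sum ht hs]
    · exact Finset.sum_congr rfl fun l _ => hpow l
    · intro l _; fun_prop
  have hk := Nat.cast_ne_zero (R := ℝ).2 (Nat.factorial_ne_zero k)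
  rw [coeff_taylorSeriesWithin, hsum, PowerSeries.ofFin, PowerSeries.coeff_mk, Finset.sum_div]
  split_ifs with h
  · simp only [Matrix.mulVec, dotProduct, taylorShift, Matrix.of_apply]
    refine Finset.sum_congr rfl fun l _ => ?_
    rw [Nat.descFactorial_eq_factorial_mul_choose]
    push_cast
    field_simp
  · refine Finset.sum_eq_zero fun l _ => ?_
    rw [Nat.descFactorial_of_lt (by omega)]
    simp

end Taylor

/-! ### Zeros of finite order -/

/-- A smooth function on a compact interval with no zero of infinite order has finitely many
zeros: by Taylor's theorem a zero of finite order is isolated. -/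
lemma finite_zeros_of_iteratedDerivWithin_ne_zero {s : Set ℝ} (hs : Convex ℝ s)
    (hsc : IsCompact s) {f : ℝ → ℝ} (hf : ContDiffOn ℝ ∞ f s)
    (h : ∀ t ∈ s, ∃ k, iteratedDerivWithin k f s t ≠ 0) : {t ∈ s | f t = 0}.Finite := by
  classical
  by_contra hinf
  obtain ⟨x, hx, hacc⟩ := Set.Infinite.exists_accPt_of_subset_isCompact hinf hsc
    (fun _ h => h.1)
  have hk := Nat.find_spec (h x hx)
  have hmin := fun i => Nat.find_min (h x hx) (m := i)
  set k := Nat.find (h x hx)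
  set c := iteratedDerivWithin k f s x / k.factorial with hc
  have hc0 : c ≠ 0 := div_ne_zero hk (Nat.cast_ne_zero.2 (Nat.factorial_ne_zero k))
  have htaylor : ∀ y, taylorWithinEval f k s x y = c * (y - x) ^ k := fun y => by
    rw [taylor_within_apply, Finset.sum_range_succ, Finset.sum_eq_zero, zero_add, hc, smul_eq_mul]
    · ring
    · intro i hi
      rw [not_not.1 (hmin i (Finset.mem_range.1 hi)), smul_zero]
  have hO := (taylor_isLittleO (n := k) hs hx (hf.of_le (by exact_mod_cast le_top))).def
    (half_pos (abs_pos.2 hc0))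
  rw [accPt_iff_frequently_nhdsNE] at hacc
  have hO' := Filter.mem_inf_principal.1 hO
  obtain ⟨y, ⟨hys, hy0⟩, hyO, hyx⟩ :=
    (hacc.and_eventually (Filter.inter_mem (mem_nhdsWithin_of_mem_nhds hO')
      (self_mem_nhdsWithin (s := {x}ᶜ)))).exists
  have h1 := hyO hys
  simp only [Set.mem_ofPred_eq, htaylor, hy0, zero_sub, Real.norm_eq_abs, abs_neg, abs_mul] at h1
  have h2 : 0 < |c| * ‖(y - x) ^ k‖ :=
    mul_pos (abs_pos.2 hc0) (norm_pos_iff.2 (pow_ne_zero _ (sub_ne_zero.2 hyx)))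
  rw [Real.norm_eq_abs] at h2
  linarith

/-! ### Partial derivatives of smooth families -/

section Family

variable {E F : Type*} [NormedAddCommGroup E] [NormedSpace ℝ E]
  [NormedAddCommGroup F] [NormedSpace ℝ F] {s : Set ℝ} {T : Set E}

lemma ContDiffOn.comp_prodMk_const {f : ℝ × E → F} (hf : ContDiffOn ℝ ∞ f (s ×ˢ T)) {x : E}
    (hx : x ∈ T) : ContDiffOn ℝ ∞ (fun t => f (t, x)) s :=
  hf.comp (contDiff_id.prodMk contDiff_const).contDiffOn fun _ ht => ⟨ht, hx⟩

lemma ContDiffOn.derivWithin_fst (hs : UniqueDiffOn ℝ s) (hT : UniqueDiffOn ℝ T) {f : ℝ × E → F}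
    (hf : ContDiffOn ℝ ∞ f (s ×ˢ T)) :
    ContDiffOn ℝ ∞ (fun z : ℝ × E => derivWithin (fun t => f (t, z.2)) s z.1) (s ×ˢ T) := by
  have h1 : ContDiffOn ℝ ∞ (fun z => fderivWithin ℝ f (s ×ˢ T) z (1, 0)) (s ×ˢ T) :=
    (hf.fderivWithin (hs.prod hT) (by simp)).clm_apply contDiffOn_const
  refine h1.congr fun z hz => ?_
  have h2 : HasFDerivWithinAt f (fderivWithin ℝ f (s ×ˢ T) z) (s ×ˢ T) (z.1, z.2) :=
    ((hf.differentiableOn (by simp)) z hz).hasFDerivWithinAt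
  have h3 : HasDerivWithinAt (fun t : ℝ => (t, z.2)) ((1 : ℝ), (0 : E)) s z.1 :=
    (hasDerivWithinAt_id _ _).prodMk (hasDerivWithinAt_const _ _ _)
  have hmaps : Set.MapsTo (fun t : ℝ => (t, z.2)) s (s ×ˢ T) := fun t ht => ⟨ht, hz.2⟩
  exact (h2.comp_hasDerivWithinAt z.1 h3 hmaps).derivWithin (hs z.1 hz.1)

lemma ContDiffOn.iteratedDerivWithin_fst (hs : UniqueDiffOn ℝ s) (hT : UniqueDiffOn ℝ T)
    {f : ℝ × E → F} (hf : ContDiffOn ℝ ∞ f (s ×ˢ T)) (k : ℕ) :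
    ContDiffOn ℝ ∞ (fun z : ℝ × E => iteratedDerivWithin k (fun t => f (t, z.2)) s z.1)
      (s ×ˢ T) := by
  induction k with
  | zero => simpa using hf
  | succ k ih =>
    simp only [iteratedDerivWithin_succ]
    exact ih.derivWithin_fst hs hT

/-- A smooth function on a set `T` is Lipschitz on compact convex subsets of `T`. -/
lemma ContDiffOn.exists_lipschitzOnWith_of_isCompact_convex {f : E → F} {T K : Set E}
    (hT : UniqueDiffOn ℝ T) (hf : ContDiffOn ℝ ∞ f T) (hKT : K ⊆ T) (hK : IsCompact K)
    (hKc : Convex ℝ K) : ∃ C, LipschitzOnWith C f K := by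
  obtain ⟨C, hC⟩ := hK.exists_bound_of_continuousOn
    ((hf.continuousOn_fderivWithin hT (by simp)).mono hKT)
  refine ⟨C.toNNReal, hKc.lipschitzOnWith_of_nnnorm_hasFDerivWithin_le
    (f' := fderivWithin ℝ f T) (fun x hx => ?_) fun x hx => ?_⟩
  · exact (((hf.differentiableOn (by simp)) x (hKT hx)).hasFDerivWithinAt).mono hKT
  · rw [← NNReal.coe_le_coe, coe_nnnorm]
    exact (hC x hx).trans (Real.le_coe_toNNReal C)

end Family

/-! ### Flat parameters form a null set -/

/-- A bounded subset of an `m`-dimensional space is divided into `L ^ m` cells of diameter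
at most `C / L`; the cell of a point is recorded by `κ`. -/
lemma Bornology.IsBounded.exists_cells {E : Type*} [NormedAddCommGroup E] [NormedSpace ℝ E]
    [FiniteDimensional ℝ E] {S : Set E} (hS : Bornology.IsBounded S) :
    ∃ C : ℝ, 0 ≤ C ∧ ∀ L : ℕ, 0 < L → ∃ κ : E → (Fin (Module.finrank ℝ E) → Fin L),
      ∀ x ∈ S, ∀ y ∈ S, κ x = κ y → dist x y ≤ C / L := by
  set φ := (Module.finBasis ℝ E).equivFunL with hφ
  obtain ⟨R, hRpos, hR⟩ := (φ.lipschitz.isBounded_image hS).exists_pos_norm_lt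
  refine ⟨‖(φ.symm : (Fin (Module.finrank ℝ E) → ℝ) →L[ℝ] E)‖ * (2 * R), by positivity,
    fun L hL => ?_⟩
  have hL' : (0 : ℝ) < L := Nat.cast_pos.2 hL
  set f : E → Fin (Module.finrank ℝ E) → ℝ := fun x i => (φ x i + R) / (2 * R) * L with hf
  refine ⟨fun x i => ⟨min ⌊f x i⌋₊ (L - 1), by omega⟩, fun x hx y hy hxy => ?_⟩
  have hrange : ∀ z ∈ S, ∀ i, 0 ≤ f z i ∧ ⌊f z i⌋₊ < L := fun z hz i => by
    have h1 : |φ z i| < R := (norm_le_pi_norm (φ z) i).trans_lt (hR _ ⟨z, hz, rfl⟩)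
    have h2 := abs_lt.1 h1
    have h3 : 0 ≤ f z i := by
      have : 0 ≤ φ z i + R := by linarith
      simp only [hf]; positivity
    refine ⟨h3, (Nat.floor_lt h3).2 ?_⟩
    have : (φ z i + R) / (2 * R) < 1 := (div_lt_one (by positivity)).2 (by linarith)
    simpa [hf] using mul_lt_mul_of_pos_right this hL'
  have hcoord : ∀ i, |φ x i - φ y i| ≤ 2 * R / L := fun i => by
    have h1 : ⌊f x i⌋₊ = ⌊f y i⌋₊ := by
      have h := congrArg Fin.val (congrFun hxy i)
      simp only at h
      have := (hrange x hx i).2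
      have := (hrange y hy i).2
      omega
    have h2 := Nat.floor_le (hrange x hx i).1
    have h3 := Nat.lt_floor_add_one (f x i)
    have h4 := Nat.floor_le (hrange y hy i).1
    have h5 := Nat.lt_floor_add_one (f y i)
    rw [← h1] at h4 h5
    have h6 : |f x i - f y i| ≤ 1 := abs_le.2 ⟨by linarith, by linarith⟩
    have h7 : φ x i - φ y i = (f x i - f y i) * (2 * R / L) := by
      simp only [hf]; field_simp; ring
    rw [h7, abs_mul, abs_of_nonneg (show 0 ≤ 2 * R / L by positivity)]
    exact mul_le_of_le_one_left (by positivity) h6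
  have hnorm : ‖φ x - φ y‖ ≤ 2 * R / L :=
    (pi_norm_le_iff_of_nonneg (by positivity)).2 hcoord
  have hsymm : x - y = (φ.symm : (Fin (Module.finrank ℝ E) → ℝ) →L[ℝ] E) (φ x - φ y) := by
    simp
  rw [dist_eq_norm, hsymm, mul_div_assoc]
  exact (ContinuousLinearMap.le_opNorm _ _).trans (by gcongr)

/-- Re-expansion at a point of `[0, 1]` sends the unit cube of coefficients into a fixed cube. The
bound is at least `1`, so that the sides of that cube have length at least `1`. -/
lemma exists_taylorShift_mulVec_mem_Icc (N : ℕ) :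
    ∃ R : ℝ, 1 ≤ R ∧ ∀ t ∈ Set.Icc (0 : ℝ) 1, ∀ a ∈ Set.Icc (-1 : Fin N → ℝ) 1,
      ∀ i, Matrix.mulVec (taylorShift N t) a i ∈ Set.Icc (-R) R := by
  have hc : Continuous fun z : ℝ × (Fin N → ℝ) => Matrix.mulVec (taylorShift N z.1) z.2 := by
    refine Continuous.matrix_mulVec (continuous_matrix fun j l => ?_) continuous_snd
    simp only [taylorShift, Matrix.of_apply]
    fun_prop
  obtain ⟨R, hR⟩ := ((isCompact_Icc (a := (0 : ℝ)) (b := 1)).prod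
    (isCompact_Icc (a := (-1 : Fin N → ℝ)) (b := 1))).exists_bound_of_continuousOn hc.continuousOn
  refine ⟨max 1 R, le_max_left _ _, fun t ht a ha i => ?_⟩
  have h := ((norm_le_pi_norm _ i).trans (hR (t, a) ⟨ht, ha⟩)).trans (le_max_right 1 R)
  exact abs_le.1 h

open PowerSeries in
/-- The sublevel estimate in terms of the coefficients of a polynomial in `x`, expanded at a point
`t` of the unit interval: re-expansion at `t` preserves volume. -/
lemma MvPolynomial.exists_volume_small_coeff_taylorShift_le {n : ℕ} (P : MvPolynomial (Fin n) ℝ)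
    (hD : P.totalDegree ≠ 0) (e : Fin n → ℝ)
    (he : eval e (homogeneousComponent P.totalDegree P) ≠ 0) {N d : ℕ}
    (hd : sparseOrder P.totalDegree d ≤ N) :
    ∃ M : ENNReal, M ≠ ⊤ ∧ ∀ t ∈ Set.Icc (0 : ℝ) 1, ∀ f : Fin n → ℝ⟦X⟧, ∀ η : ℝ, 0 < η →
      volume {a : Fin N → ℝ | a ∈ Set.Icc (-1 : Fin N → ℝ) 1 ∧
        ∀ r < d, |PowerSeries.coeff (sparseOrder P.totalDegree r * P.totalDegree)
          (aeval (fun j => f j + PowerSeries.ofFin (Matrix.mulVec (taylorShift N t) a) *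
            PowerSeries.C (e j)) P)| ≤
          |eval e (homogeneousComponent P.totalDegree P)| * η ^ P.totalDegree} ≤
      ENNReal.ofReal (2 * P.totalDegree * η) ^ d * M := by
  obtain ⟨R, hR1, hR⟩ := exists_taylorShift_mulVec_mem_Icc N
  set μ : Fin N → Measure ℝ := fun _ => volume.restrict (Set.Icc (-R) R) with hμ
  refine ⟨Measure.pi μ Set.univ, measure_ne_top _ _, fun t ht f η hη => ?_⟩
  have h1 := P.measure_small_coeff_le hD e he μ (fun i => ?_) (fun i => Measure.restrict_le_self)
    d hd f hη
  · refine le_trans ?_ h1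
    set S := {b : Fin N → ℝ | ∀ r < d, |PowerSeries.coeff (sparseOrder P.totalDegree r *
        P.totalDegree) (aeval (fun j => f j + PowerSeries.ofFin b * PowerSeries.C (e j)) P)| ≤
        |eval e (homogeneousComponent P.totalDegree P)| * η ^ P.totalDegree} with hS
    have hdet : LinearMap.det (Matrix.toLin' (taylorShift N t)) = 1 := by
      rw [LinearMap.det_toLin', det_taylorShift]
    calc _ ≤ volume (Matrix.toLin' (taylorShift N t) ⁻¹'
            (S ∩ Set.univ.pi fun _ => Set.Icc (-R) R)) :=
          measure_mono fun a ha => ⟨ha.2, fun i _ => hR t ht a ha.1 i⟩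
      _ = volume (S ∩ Set.univ.pi fun _ => Set.Icc (-R) R) := by
          rw [Measure.addHaar_preimage_linearMap _ (by rw [hdet]; exact one_ne_zero), hdet]
          simp
      _ = Measure.pi μ S := by
          rw [hμ, ← Measure.restrict_pi_pi, Measure.restrict_apply' ]
          · rfl
          · exact MeasurableSet.univ_pi fun _ => measurableSet_Icc
  · simp only [hμ, Measure.restrict_apply_univ, Real.volume_Icc]
    rw [← ENNReal.ofReal_one]
    exact ENNReal.ofReal_le_ofReal (by linarith)

/-- The family of curves `γ (·, x)`, moved in the direction `e` by the polynomial with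
coefficients `a`. -/
def perturbedFamily {n N : ℕ} {E : Type*} (γ : ℝ × E → EuclideanSpace ℝ (Fin n)) (e : Fin n → ℝ)
    (a : Fin N → ℝ) (x : E) (s : ℝ) : Fin n → ℝ :=
  fun i => γ (s, x) i + (∑ l, a l * s ^ (l : ℕ)) * e i

lemma contDiffOn_eval_perturbedFamily {n N : ℕ} (P : MvPolynomial (Fin n) ℝ) (e : Fin n → ℝ)
    {E : Type*} [NormedAddCommGroup E] [NormedSpace ℝ E] {s : Set ℝ} {T : Set E}
    {γ : ℝ × E → EuclideanSpace ℝ (Fin n)} (hγ : ContDiffOn ℝ ∞ γ (s ×ˢ T)) :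
    ContDiffOn ℝ ∞ (fun z : ℝ × (E × (Fin N → ℝ)) =>
      MvPolynomial.eval (perturbedFamily γ e z.2.2 z.2.1 z.1) P)
      (s ×ˢ (T ×ˢ (Set.univ : Set (Fin N → ℝ)))) := by
  suffices hc : ∀ j, ContDiffOn ℝ ∞ (fun z : ℝ × (E × (Fin N → ℝ)) =>
      perturbedFamily γ e z.2.2 z.2.1 z.1 j) (s ×ˢ (T ×ˢ (Set.univ : Set (Fin N → ℝ)))) from
    ContDiffOn.mvPolynomial_eval hc P
  intro j
  have h0 : ContDiff ℝ ∞ fun z : ℝ × (E × (Fin N → ℝ)) => (z.1, z.2.1) :=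
    contDiff_fst.prodMk (contDiff_fst.comp contDiff_snd)
  have h1 : ContDiffOn ℝ ∞ (fun z : ℝ × (E × (Fin N → ℝ)) => γ (z.1, z.2.1))
      (s ×ˢ (T ×ˢ (Set.univ : Set (Fin N → ℝ)))) :=
    ContDiffOn.comp (g := γ) (f := fun z : ℝ × (E × (Fin N → ℝ)) => (z.1, z.2.1)) hγ
      h0.contDiffOn (fun z hz => ⟨hz.1, hz.2.1⟩)
  have h3 : ContDiff ℝ ∞ fun z : ℝ × (E × (Fin N → ℝ)) =>
      (∑ l, z.2.2 l * z.1 ^ (l : ℕ)) * e j := by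
    refine ContDiff.mul (ContDiff.sum fun l _ => ContDiff.mul ?_ ?_) contDiff_const
    · exact (contDiff_apply ℝ ℝ l).comp (contDiff_snd.comp contDiff_snd)
    · exact contDiff_fst.pow _
  have h4 := (contDiffOn_euclidean.1 h1) j
  exact h4.add h3.contDiffOn

lemma taylorSeriesWithin_eval_perturbedFamily {n N : ℕ} (P : MvPolynomial (Fin n) ℝ)
    (e : Fin n → ℝ) {E : Type*} [NormedAddCommGroup E] [NormedSpace ℝ E] {s : Set ℝ}
    (hs : UniqueDiffOn ℝ s) {t : ℝ} (ht : t ∈ s) {T : Set E} {x : E} (hx : x ∈ T)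
    {γ : ℝ × E → EuclideanSpace ℝ (Fin n)} (hγ : ContDiffOn ℝ ∞ γ (s ×ˢ T)) (a : Fin N → ℝ) :
    taylorSeriesWithin (fun τ => MvPolynomial.eval (perturbedFamily γ e a x τ) P) s t =
      MvPolynomial.aeval (fun j => taylorSeriesWithin (fun τ => γ (τ, x) j) s t +
        PowerSeries.ofFin (Matrix.mulVec (taylorShift N t) a) * PowerSeries.C (e j)) P := by
  have hγj : ∀ j, ContDiffOn ℝ ∞ (fun τ => γ (τ, x) j) s :=
    contDiffOn_euclidean.1 (hγ.comp_prodMk_const hx)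
  have hp : ContDiff ℝ ∞ fun τ : ℝ => ∑ l, a l * τ ^ (l : ℕ) := by fun_prop
  have h1 : ∀ j, taylorSeriesWithin (fun τ => perturbedFamily γ e a x τ j) s t =
      taylorSeriesWithin (fun τ => γ (τ, x) j) s t +
        PowerSeries.ofFin (Matrix.mulVec (taylorShift N t) a) * PowerSeries.C (e j) := fun j => by
    simp only [perturbedFamily]
    rw [taylorSeriesWithin_add hs ht (hγj j) (hp.mul contDiff_const).contDiffOn,
      taylorSeriesWithin_mul hs ht hp.contDiffOn contDiffOn_const, taylorSeriesWithin_const,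
      taylorSeriesWithin_sum_pow hs ht]
  simp only [← h1]
  exact taylorSeriesWithin_mvPolynomial_eval hs ht
    (fun j => (hγj j).add (hp.mul contDiff_const).contDiffOn) P

/-- For almost every small perturbation of a smooth family of curves by polynomial curves of large
degree in the direction `e`, the polynomial `P` has no zero of infinite order on any curve of the
family over `K`. Such a zero forces all controlled Taylor coefficients to be small at a chosen point
of its cell in `[0, 1] × K`. There are `q ^ (D * (dim E + 1))` cells, of diameter `O (q ^ (-D))`, and
the parameters lost at each have measure `O (q ^ (-(D * (dim E + 1) + 1)))`. -/
theorem MvPolynomial.volume_flat_parameters_eq_zero {n : ℕ} (P : MvPolynomial (Fin n) ℝ)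
    (hD : P.totalDegree ≠ 0) (e : Fin n → ℝ)
    (he : eval e (homogeneousComponent P.totalDegree P) ≠ 0)
    {E : Type*} [NormedAddCommGroup E] [NormedSpace ℝ E] [FiniteDimensional ℝ E]
    {T K : Set E} (hT : UniqueDiffOn ℝ T) (hKT : K ⊆ T) (hK : IsCompact K) (hKc : Convex ℝ K)
    {γ : ℝ × E → EuclideanSpace ℝ (Fin n)} (hγ : ContDiffOn ℝ ∞ γ (Set.Icc 0 1 ×ˢ T)) {N : ℕ}
    (hN : sparseOrder P.totalDegree (P.totalDegree * (Module.finrank ℝ E + 1) + 1) ≤ N) :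
    volume {a : Fin N → ℝ | a ∈ Set.Icc (-1 : Fin N → ℝ) 1 ∧ ∃ t ∈ Set.Icc (0 : ℝ) 1, ∃ x ∈ K,
      ∀ k, iteratedDerivWithin k (fun s => eval (perturbedFamily γ e a x s) P)
        (Set.Icc 0 1) t = 0} = 0 := by
  classical
  set D := P.totalDegree with hDdef
  set c := eval e (homogeneousComponent D P) with hc
  set m := Module.finrank ℝ E + 1 with hm
  set d := D * m + 1 with hd
  set I := Set.Icc (0 : ℝ) 1 with hI
  have hIu : UniqueDiffOn ℝ I := uniqueDiffOn_Icc zero_lt_one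
  set B := Set.Icc (-1 : Fin N → ℝ) 1 with hB
  -- The controlled Taylor coefficients, as a smooth function of time, point and parameter.
  set Φ : ℝ × (E × (Fin N → ℝ)) → ℝ :=
    fun z => eval (perturbedFamily γ e z.2.2 z.2.1 z.1) P with hΦ
  have hΦs : ContDiffOn ℝ ∞ Φ (I ×ˢ (T ×ˢ Set.univ)) := contDiffOn_eval_perturbedFamily P e hγ
  have hTu : UniqueDiffOn ℝ (T ×ˢ (Set.univ : Set (Fin N → ℝ))) := hT.prod uniqueDiffOn_univ
  set Ψ : ℝ × (E × (Fin N → ℝ)) → Fin d → ℝ := fun z r =>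
    iteratedDerivWithin (sparseOrder D r * D) (fun s => Φ (s, z.2)) I z.1 /
      (sparseOrder D r * D).factorial with hΨ
  have hΨs : ContDiffOn ℝ ∞ Ψ (I ×ˢ (T ×ˢ Set.univ)) := contDiffOn_pi.2 fun r =>
    (ContDiffOn.iteratedDerivWithin_fst hIu hTu hΦs (sparseOrder D r * D)).div_const _
  obtain ⟨C₁, hC₁⟩ := hΨs.exists_lipschitzOnWith_of_isCompact_convex (hIu.prod hTu)
    (K := I ×ˢ (K ×ˢ B))
    (Set.prod_mono subset_rfl (Set.prod_mono hKT (Set.subset_univ _)))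
    (isCompact_Icc.prod (hK.prod isCompact_Icc))
    ((convex_Icc _ _).prod (hKc.prod (convex_Icc _ _)))
  obtain ⟨M, hM, hMle⟩ := P.exists_volume_small_coeff_taylorShift_le hD e he hN
  have hΨcoeff : ∀ t ∈ I, ∀ x ∈ K, ∀ a : Fin N → ℝ, ∀ r : Fin d, Ψ (t, (x, a)) r =
      PowerSeries.coeff (sparseOrder D r * D)
        (aeval (fun j => taylorSeriesWithin (fun s => γ (s, x) j) I t +
          PowerSeries.ofFin (Matrix.mulVec (taylorShift N t) a) * PowerSeries.C (e j)) P) := by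
    intro t ht x hx a r
    rw [← taylorSeriesWithin_eval_perturbedFamily P e hIu ht (hKT hx) hγ, coeff_taylorSeriesWithin]
  obtain ⟨C₂, hC₂, hcells⟩ := (isCompact_Icc.prod hK : IsCompact (I ×ˢ K)).isBounded.exists_cells
  have hfin : Module.finrank ℝ (ℝ × E) = m := by
    rw [Module.finrank_prod, Module.finrank_self, add_comm]
  -- The smallness parameter will be `η = A / q`; the constant `A` makes `|c| * η ^ D` dominate the
  -- variation of the coefficients over a cell.
  set A := 1 + C₁ * C₂ / |c| with hA
  have hcpos : 0 < |c| := abs_pos.2 he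
  have hA1 : 1 ≤ A := le_add_of_nonneg_right (by positivity)
  have hAD : C₁ * C₂ ≤ |c| * A ^ D := by
    have h1 : C₁ * C₂ / |c| ≤ A ^ D :=
      (by linarith : C₁ * C₂ / |c| ≤ A).trans (le_self_pow₀ hA1 hD)
    rwa [div_le_iff₀' hcpos] at h1
  set bad := {a : Fin N → ℝ | a ∈ B ∧ ∃ t ∈ I, ∃ x ∈ K,
      ∀ k, iteratedDerivWithin k (fun s => eval (perturbedFamily γ e a x s) P) I t = 0} with hbad
  have hbound : ∀ q : ℕ, 0 < q →
      volume bad ≤ ENNReal.ofReal ((2 * D * A) ^ d / q) * M := fun q hq => by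
    have hq' : (0 : ℝ) < q := Nat.cast_pos.2 hq
    obtain ⟨κ, hκ⟩ := hcells (q ^ D) (pow_pos hq D)
    set η := A / q with hη
    have hη0 : 0 < η := by positivity
    -- A cell gathers the parameters for which some zero of infinite order lies in it.
    set cell : (Fin (Module.finrank ℝ (ℝ × E)) → Fin (q ^ D)) → Set (Fin N → ℝ) := fun v =>
      {a | a ∈ B ∧ ∃ t ∈ I, ∃ x ∈ K, κ (t, x) = v ∧ ∀ k,
        iteratedDerivWithin k (fun s => eval (perturbedFamily γ e a x s) P) I t = 0} with hcell
    have hcover : bad ⊆ ⋃ v, cell v := fun a ⟨ha, t, ht, x, hx, h⟩ =>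
      Set.mem_iUnion.2 ⟨κ (t, x), ha, t, ht, x, hx, rfl, h⟩
    have hcellvol : ∀ v, volume (cell v) ≤ ENNReal.ofReal (2 * D * η) ^ d * M := fun v => by
      rcases (cell v).eq_empty_or_nonempty with hv | ⟨_, _, t₀, ht₀, x₀, hx₀, hv₀, _⟩
      · rw [hv, measure_empty]; exact zero_le
      refine (measure_mono fun a ha => ?_).trans
        (hMle t₀ ht₀ (fun j => taylorSeriesWithin (fun s => γ (s, x₀) j) I t₀) η hη0)
      obtain ⟨haB, t, ht, x, hx, hv, hflat⟩ := ha
      refine ⟨haB, fun r hr => ?_⟩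
      have hdist : dist (t₀, x₀) (t, x) ≤ C₂ / (q : ℝ) ^ D := by
        simpa using hκ _ ⟨ht₀, hx₀⟩ _ ⟨ht, hx⟩ (hv₀.trans hv.symm)
      have hdist' : dist (t₀, (x₀, a)) (t, (x, a)) ≤ C₂ / (q : ℝ) ^ D := by
        simpa [Prod.dist_eq] using hdist
      have hL := hC₁.dist_le_mul (t₀, (x₀, a)) ⟨ht₀, hx₀, haB⟩ (t, (x, a)) ⟨ht, hx, haB⟩
      have hzero : Ψ (t, (x, a)) ⟨r, hr⟩ = 0 := by
        simp only [hΨ, hΦ, hflat, zero_div]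
      have h1 := (dist_le_pi_dist (Ψ (t₀, (x₀, a))) (Ψ (t, (x, a))) ⟨r, hr⟩).trans hL
      rw [hzero, hΨcoeff t₀ ht₀ x₀ hx₀, dist_zero_right, Real.norm_eq_abs] at h1
      refine h1.trans ?_
      calc (C₁ : ℝ) * dist (t₀, (x₀, a)) (t, (x, a)) ≤ C₁ * (C₂ / (q : ℝ) ^ D) := by gcongr
        _ = C₁ * C₂ / (q : ℝ) ^ D := by ring
        _ ≤ |c| * A ^ D / (q : ℝ) ^ D := by gcongr
        _ = |c| * η ^ D := by rw [hη, div_pow]; ring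
    calc volume bad ≤ ∑ v, volume (cell v) :=
          (measure_mono hcover).trans (measure_iUnion_fintype_le _ _)
      _ ≤ ∑ _v : Fin (Module.finrank ℝ (ℝ × E)) → Fin (q ^ D),
            ENNReal.ofReal (2 * D * η) ^ d * M := Finset.sum_le_sum fun v _ => hcellvol v
      _ = ENNReal.ofReal ((q : ℝ) ^ (D * m)) * (ENNReal.ofReal (2 * D * η) ^ d * M) := by
          rw [Finset.sum_const, Finset.card_univ, Fintype.card_fun, Fintype.card_fin,
            Fintype.card_fin, hfin, ← pow_mul, nsmul_eq_mul, ENNReal.ofReal_pow hq'.le,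
            ENNReal.ofReal_natCast, Nat.cast_pow]
      _ = ENNReal.ofReal ((2 * D * A) ^ d / q) * M := by
          rw [← mul_assoc, ← ENNReal.ofReal_pow (by positivity),
            ← ENNReal.ofReal_mul (by positivity)]
          congr 2
          rw [hη, hd, pow_succ, pow_succ, ← mul_div_assoc, div_pow]
          field_simp
  have hlim : Filter.Tendsto (fun q : ℕ => ENNReal.ofReal ((2 * D * A) ^ d / q) * M) Filter.atTop
      (nhds 0) := by
    have h1 := (tendsto_const_div_atTop_nhds_zero_nat ((2 * D * A) ^ d))
    have h2 := ENNReal.Tendsto.mul_const (ENNReal.tendsto_ofReal h1) (Or.inr hM) (b := M)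
    simpa using h2
  exact le_antisymm (ge_of_tendsto hlim
    (Filter.eventually_atTop.2 ⟨1, fun q hq => hbound q hq⟩)) (zero_le)

/-! ### The smooth topology in charts -/

section Charts

open Filter Topology

variable {E : Type*} [NormedAddCommGroup E] [NormedSpace ℝ E]
  {H : Type*} [TopologicalSpace H] {J : ModelWithCorners ℝ E H}
  {M : Type*} [TopologicalSpace M]

lemma OpenPartialHomeomorph.uniqueDiffOn_extend_target (φ : OpenPartialHomeomorph M H) :
    UniqueDiffOn ℝ (φ.extend J).target := by
  rw [φ.extend_target]
  exact J.uniqueDiffOn_preimage φ.open_target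

/-- In a finite-dimensional model, every point of the target of an extended chart has a compact
convex neighborhood within the target: the target is locally the convex range of the model. -/
lemma OpenPartialHomeomorph.exists_isCompact_convex_subset_extend_target [FiniteDimensional ℝ E]
    (φ : OpenPartialHomeomorph M H) {y : E} (hy : y ∈ (φ.extend J).target) :
    ∃ K ⊆ (φ.extend J).target, IsCompact K ∧ Convex ℝ K ∧ K ∈ 𝓝[(φ.extend J).target] y := by
  have hmem : (φ.extend J).target ∈ 𝓝[Set.range J] y := by
    have hsource : (φ.extend J).symm y ∈ φ.source := by
      simpa only [φ.extend_source] using (φ.extend J).map_target hy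
    have h := φ.extend_target_mem_nhdsWithin (I := J) hsource
    rwa [(φ.extend J).right_inv hy] at h
  obtain ⟨ε, hε, hsub⟩ := Metric.mem_nhdsWithin_iff.1 hmem
  refine ⟨Metric.closedBall y (ε / 2) ∩ Set.range J, ?_, ?_, ?_, ?_⟩
  · exact (Set.inter_subset_inter_left _
      (Metric.closedBall_subset_ball (half_lt_self hε))).trans hsub
  · exact (isCompact_closedBall y _).inter_right J.isClosed_range
  · exact (convex_closedBall y _).inter J.convex_range
  · refine inter_mem (mem_nhdsWithin_of_mem_nhds (Metric.closedBall_mem_nhds y (half_pos hε))) ?_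
    exact mem_of_superset self_mem_nhdsWithin (φ.extend_target_subset_range)

variable [ChartedSpace H M] {F : Type*} [NormedAddCommGroup F] [NormedSpace ℝ F]

lemma ContMDiffMap.contDiffOn_comp_extend_symm {φ : OpenPartialHomeomorph M H}
    (hφ : φ ∈ IsManifold.maximalAtlas J ∞ M) (G : C^∞⟮J, M; 𝓘(ℝ, F), F⟯) :
    ContDiffOn ℝ ∞ (G ∘ (φ.extend J).symm) (φ.extend J).target := by
  rw [← contMDiffOn_iff_contDiffOn, φ.extend_target']
  exact G.contMDiff.comp_contMDiffOn (contMDiffOn_extend_symm hφ)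

/-- The derivatives of the coordinate expression depend jointly continuously on the map and on the
point. -/
lemma ContMDiffMap.tendsto_iteratedFDerivWithin_extend [FiniteDimensional ℝ E]
    {φ : OpenPartialHomeomorph M H} (hφ : φ ∈ IsManifold.maximalAtlas J ∞ M) (k : ℕ)
    {ι : Type*} {p : Filter ι} {G : ι → C^∞⟮J, M; 𝓘(ℝ, F), F⟯} {G₀ : C^∞⟮J, M; 𝓘(ℝ, F), F⟯}
    (hG : Tendsto G p (𝓝 G₀)) {y : ι → E} {y₀ : E} (hy₀ : y₀ ∈ (φ.extend J).target)
    (hy : Tendsto y p (𝓝[(φ.extend J).target] y₀)) :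
    Tendsto (fun i => iteratedFDerivWithin ℝ k (G i ∘ (φ.extend J).symm) (φ.extend J).target (y i))
      p (𝓝 (iteratedFDerivWithin ℝ k (G₀ ∘ (φ.extend J).symm) (φ.extend J).target y₀)) := by
  obtain ⟨K, hKsub, hK, -, hKy⟩ := φ.exists_isCompact_convex_subset_extend_target hy₀
  have hcont : Continuous (fun G : C^∞⟮J, M; 𝓘(ℝ, F), F⟯ =>
      UniformOnFun.ofFun {K : Set E | IsCompact K ∧ K ⊆ (φ.extend J).target}
        (iteratedFDerivWithin ℝ k (G ∘ (φ.extend J).symm) (φ.extend J).target)) :=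
    continuous_iInf_dom (i := φ) (continuous_iInf_dom (i := hφ)
      (continuous_iInf_dom (i := k) continuous_induced_dom))
  have hunif := UniformOnFun.tendsto_iff_tendstoUniformlyOn.1 ((hcont.tendsto G₀).comp hG) K
    ⟨hK, hKsub⟩
  have hc : ContinuousOn
      (iteratedFDerivWithin ℝ k (G₀ ∘ (φ.extend J).symm) (φ.extend J).target)
      (φ.extend J).target :=
    (ContMDiffMap.contDiffOn_comp_extend_symm hφ G₀).continuousOn_iteratedFDerivWithin
      (by exact_mod_cast le_top) φ.uniqueDiffOn_extend_target
  refine hunif.tendsto_comp ((hc y₀ hy₀).mono hKsub) ?_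
  exact tendsto_nhdsWithin_iff.2 ⟨hy.mono_right nhdsWithin_le_nhds, hy hKy⟩

/-- Finite-dimensional affine families of smooth maps are continuous in the parameters. -/
lemma ContMDiffMap.continuous_add_sum_smul {N : ℕ} (G : C^∞⟮J, M; 𝓘(ℝ, F), F⟯)
    (h : Fin N → C^∞⟮J, M; 𝓘(ℝ, F), F⟯) :
    Continuous fun a : Fin N → ℝ => G + ∑ l, a l • h l := by
  refine continuous_iInf_rng.2 fun φ => continuous_iInf_rng.2 fun hφ =>
    continuous_iInf_rng.2 fun k => continuous_induced_rng.2 ?_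
  set T := (φ.extend J).target with hTdef
  have hT : UniqueDiffOn ℝ T := φ.uniqueDiffOn_extend_target
  have hk : ((k : ℕ) : WithTop ℕ∞) ≤ ∞ := by exact_mod_cast le_top
  have hsm : ∀ G : C^∞⟮J, M; 𝓘(ℝ, F), F⟯, ∀ y ∈ T,
      ContDiffWithinAt ℝ k (G ∘ (φ.extend J).symm) T y := fun G y hy =>
    (ContMDiffMap.contDiffOn_comp_extend_symm hφ G y hy).of_le hk
  set D : C^∞⟮J, M; 𝓘(ℝ, F), F⟯ → E → E [×k]→L[ℝ] F :=
    fun G => iteratedFDerivWithin ℝ k (G ∘ (φ.extend J).symm) T with hD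
  have hlin : ∀ a : Fin N → ℝ, ∀ y ∈ T,
      D (G + ∑ l, a l • h l) y = D G y + ∑ l, a l • D (h l) y := by
    intro a y hy
    have h1 : ((G + ∑ l, a l • h l : C^∞⟮J, M; 𝓘(ℝ, F), F⟯) : M → F) ∘ (φ.extend J).symm =
        (G ∘ (φ.extend J).symm) + ∑ l, a l • (h l ∘ (φ.extend J).symm) := by
      ext x
      have h2 : ((∑ l, a l • h l : C^∞⟮J, M; 𝓘(ℝ, F), F⟯) : M → F) = ∑ l, a l • ⇑(h l) := by
        have := map_sum (ContMDiffMap.coeFnAddMonoidHom (I := J) (I' := 𝓘(ℝ, F)) (N := M)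
          (G := F) (n := ∞)) (fun l => a l • h l) Finset.univ
        exact this
      simp [h2, Finset.sum_apply]
    have h3 : ∀ l, ContDiffWithinAt ℝ k (a l • (h l ∘ (φ.extend J).symm)) T y := fun l =>
      (hsm (h l) y hy).const_smul (a l)
    simp only [hD]
    rw [h1, iteratedFDerivWithin_add_apply (hsm G y hy) ?_ hT hy,
      iteratedFDerivWithin_sum_apply hT hy fun l _ => h3 l]
    · congr 1
      exact Finset.sum_congr rfl fun l _ => iteratedFDerivWithin_const_smul_apply
        (hsm (h l) y hy) hT hy
    · have := ContDiffWithinAt.sum (s := Finset.univ) fun l _ => h3 l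
      convert! this using 1
      ext x
      simp
  refine continuous_iff_continuousAt.2 fun a₀ =>
    UniformOnFun.tendsto_iff_tendstoUniformlyOn.2 fun K hK => ?_
  have hbound : ∀ l, ∃ C, ∀ y ∈ K, ‖D (h l) y‖ ≤ C := fun l =>
    hK.1.exists_bound_of_continuousOn
      (((ContMDiffMap.contDiffOn_comp_extend_symm hφ (h l)).continuousOn_iteratedFDerivWithin
        hk hT).mono hK.2)
  choose C hC using hbound
  rw [Metric.tendstoUniformlyOn_iff]
  intro ε hε
  have hlim : Tendsto (fun a : Fin N → ℝ => ∑ l, |a₀ l - a l| * C l) (𝓝 a₀) (𝓝 0) := by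
    have : Continuous fun a : Fin N → ℝ => ∑ l, |a₀ l - a l| * C l := by fun_prop
    simpa using this.tendsto a₀
  filter_upwards [hlim.eventually (gt_mem_nhds hε)] with a ha y hy
  refine lt_of_le_of_lt ?_ ha
  change dist (D (G + ∑ l, a₀ l • h l) y) (D (G + ∑ l, a l • h l) y) ≤ _
  rw [hlin a₀ y (hK.2 hy), hlin a y (hK.2 hy), dist_add_left, dist_eq_norm,
    ← Finset.sum_sub_distrib]
  refine (norm_sum_le _ _).trans (Finset.sum_le_sum fun l _ => ?_)
  rw [← sub_smul, norm_smul, Real.norm_eq_abs]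
  exact mul_le_mul_of_nonneg_left (hC l y hy) (abs_nonneg _)

end Charts

/-! ### Derivatives in the time direction -/

section Time

open Filter Topology

/-- Along a line, iterated derivatives are iterated Fréchet derivatives in the direction of the
line. -/
lemma ContDiffOn.iteratedDerivWithin_comp_line {E F : Type*} [NormedAddCommGroup E]
    [NormedSpace ℝ E] [NormedAddCommGroup F] [NormedSpace ℝ F] {g : E → F} {T : Set E}
    (hg : ContDiffOn ℝ ∞ g T) (hT : UniqueDiffOn ℝ T) {s : Set ℝ} (hs : UniqueDiffOn ℝ s)
    (y v : E) (hmaps : ∀ τ ∈ s, y + τ • v ∈ T) (k : ℕ) {t : ℝ} (ht : t ∈ s) :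
    iteratedDerivWithin k (fun τ => g (y + τ • v)) s t =
      iteratedFDerivWithin ℝ k g T (y + t • v) fun _ => v := by
  induction k generalizing t with
  | zero => simp
  | succ k ih =>
    rw [iteratedDerivWithin_succ, derivWithin_congr (fun τ hτ => ih hτ) (ih ht),
      iteratedFDerivWithin_succ_apply_left]
    have h1 : DifferentiableWithinAt ℝ (iteratedFDerivWithin ℝ k g T) T (y + t • v) :=
      hg.differentiableOn_iteratedFDerivWithin (by exact_mod_cast ENat.natCast_lt_top k) hT _
        (hmaps t ht)
    have h2 : HasDerivWithinAt (fun τ : ℝ => y + τ • v) v s t := by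
      simpa using ((hasDerivWithinAt_id t s).smul_const v).const_add y
    have h3 := h1.hasFDerivWithinAt.comp_hasDerivWithinAt t h2 hmaps
    have h4 := (ContinuousMultilinearMap.apply ℝ (fun _ : Fin k => E) F
      (fun _ => v)).hasFDerivAt.comp_hasDerivWithinAt t h3
    exact h4.derivWithin (hs t ht)

/-- Near each of its points, the chart of the unit interval at this point is affine. -/
lemma exists_extChartAt_Icc_eq_line (t₀ : Set.Icc (0 : ℝ) 1) :
    ∃ (b v : EuclideanSpace ℝ (Fin 1)) (o : Set ℝ), IsOpen o ∧ (t₀ : ℝ) ∈ o ∧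
      ∀ t : Set.Icc (0 : ℝ) 1, (t : ℝ) ∈ o → t ∈ (extChartAt (𝓡∂ 1) t₀).source ∧
        extChartAt (𝓡∂ 1) t₀ t = b + (t : ℝ) • v := by
  by_cases h : (t₀ : ℝ) < 1
  · refine ⟨0, WithLp.toLp 2 fun _ => 1, Set.Iio 1, isOpen_Iio, h, fun t ht => ⟨?_, ?_⟩⟩
    · simpa [extChartAt_source, Icc_chartedSpaceChartAt, h, IccLeftChart] using ht
    · ext i
      simp [extChartAt, Icc_chartedSpaceChartAt, h, IccLeftChart]
  · refine ⟨WithLp.toLp 2 fun _ => 1, WithLp.toLp 2 fun _ => -1, Set.Ioi 0, isOpen_Ioi,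
      zero_lt_one.trans_le (not_lt.1 h), fun t ht => ⟨?_, ?_⟩⟩
    · simpa [extChartAt_source, Icc_chartedSpaceChartAt, h, IccRightChart] using ht
    · ext i
      simp [extChartAt, Icc_chartedSpaceChartAt, h, IccRightChart, sub_eq_add_neg]

variable {E : Type*} [NormedAddCommGroup E] [NormedSpace ℝ E]
  {H : Type*} [TopologicalSpace H] {J : ModelWithCorners ℝ E H}
  {W : Type*} [TopologicalSpace W] [ChartedSpace H W]
  {F : Type*} [NormedAddCommGroup F] [NormedSpace ℝ F]

/-- The curve `s ↦ G (s, u)`, extended to the real line by the projection onto `[0, 1]`. -/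
noncomputable def timeCurve (G : Set.Icc (0 : ℝ) 1 × W → F) (u : W) (s : ℝ) : F :=
  G (Set.projIcc 0 1 zero_le_one s, u)

lemma contDiffOn_timeCurve_extChartAt_symm [IsManifold J ∞ W]
    (G : C^∞⟮(𝓡∂ 1).prod J, Set.Icc (0 : ℝ) 1 × W; 𝓘(ℝ, F), F⟯) (u₀ : W) :
    ContDiffOn ℝ ∞ (fun z : ℝ × E => timeCurve G ((extChartAt J u₀).symm z.2) z.1)
      (Set.Icc 0 1 ×ˢ (extChartAt J u₀).target) := by
  have h : ContMDiffOn (𝓘(ℝ, ℝ).prod 𝓘(ℝ, E)) 𝓘(ℝ, F) ∞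
      (G ∘ Prod.map (Set.projIcc (0 : ℝ) 1 zero_le_one) (extChartAt J u₀).symm)
      (Set.Icc 0 1 ×ˢ (extChartAt J u₀).target) :=
    G.contMDiff.comp_contMDiffOn
      ((contMDiffOn_projIcc (x := 0) (y := 1)).prodMap (contMDiffOn_extChartAt_symm u₀))
  rw [← modelWithCornersSelf_prod, chartedSpaceSelf_prod] at h
  exact contMDiffOn_iff_contDiffOn.1 h

lemma contDiffOn_timeCurve [IsManifold J ∞ W]
    (G : C^∞⟮(𝓡∂ 1).prod J, Set.Icc (0 : ℝ) 1 × W; 𝓘(ℝ, F), F⟯) (u : W) :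
    ContDiffOn ℝ ∞ (timeCurve G u) (Set.Icc 0 1) := by
  have h := (contDiffOn_timeCurve_extChartAt_symm G u).comp_prodMk_const
    (mem_extChartAt_target (I := J) u)
  simpa only [extChartAt_to_inv] using h

/-- The time derivatives of `G (·, u)` at `t` depend jointly continuously on `G`, `t` and `u`. -/
lemma continuous_iteratedDerivWithin_timeCurve [FiniteDimensional ℝ E] [IsManifold J ∞ W] (k : ℕ) :
    Continuous fun q : C^∞⟮(𝓡∂ 1).prod J, Set.Icc (0 : ℝ) 1 × W; 𝓘(ℝ, F), F⟯ ×
        (Set.Icc (0 : ℝ) 1 × W) =>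
      iteratedDerivWithin k (timeCurve q.1 q.2.2) (Set.Icc 0 1) (q.2.1 : ℝ) := by
  set I' := (𝓡∂ 1).prod J with hI'
  refine continuous_iff_continuousAt.2 fun ⟨G₀, z₀⟩ => ?_
  obtain ⟨b, v, o, ho, hto, hline⟩ := exists_extChartAt_Icc_eq_line z₀.1
  set χ := extChartAt I' z₀ with hχ
  set T := χ.target with hT
  have hTu : UniqueDiffOn ℝ T := OpenPartialHomeomorph.uniqueDiffOn_extend_target _
  have hatlas : chartAt (ModelProd (EuclideanHalfSpace 1) H) z₀ ∈
      IsManifold.maximalAtlas I' ∞ (Set.Icc (0 : ℝ) 1 × W) :=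
    IsManifold.chart_mem_maximalAtlas z₀
  have hprod : ∀ z : Set.Icc (0 : ℝ) 1 × W, χ z =
      (extChartAt (𝓡∂ 1) z₀.1 z.1, extChartAt J z₀.2 z.2) := fun z => by
    rw [hχ, extChartAt_prod]; rfl
  have hsource : ∀ z : Set.Icc (0 : ℝ) 1 × W, (z.1 : ℝ) ∈ o →
      z.2 ∈ (extChartAt J z₀.2).source → z ∈ χ.source := fun z h1 h2 => by
    rw [hχ, extChartAt_prod]; exact ⟨(hline z.1 h1).1, h2⟩
  -- In the product chart at `z₀`, the time lines are straight lines with constant velocity `v`.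
  have hkey : ∀ (G : C^∞⟮I', Set.Icc (0 : ℝ) 1 × W; 𝓘(ℝ, F), F⟯) (z : Set.Icc (0 : ℝ) 1 × W),
      (z.1 : ℝ) ∈ o → z.2 ∈ (extChartAt J z₀.2).source →
      iteratedDerivWithin k (timeCurve G z.2) (Set.Icc 0 1) (z.1 : ℝ) =
        iteratedFDerivWithin ℝ k (G ∘ χ.symm) T (χ z) fun _ => (v, 0) := by
    intro G z hz1 hz2
    have hg : ContDiffOn ℝ ∞ (G ∘ χ.symm) T := G.contDiffOn_comp_extend_symm hatlas
    set y : EuclideanSpace ℝ (Fin 1) × E := (b, extChartAt J z₀.2 z.2) with hy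
    have hχline : ∀ t : Set.Icc (0 : ℝ) 1, (t : ℝ) ∈ o → χ (t, z.2) = y + (t : ℝ) • (v, 0) :=
      fun t ht => by rw [hprod, (hline t ht).2, hy]; simp
    have hproj : ∀ τ (hτ : τ ∈ Set.Icc (0 : ℝ) 1),
        Set.projIcc 0 1 zero_le_one τ = ⟨τ, hτ⟩ := fun τ hτ => Set.projIcc_of_mem _ hτ
    have hs : UniqueDiffOn ℝ (Set.Icc (0 : ℝ) 1 ∩ o) :=
      (uniqueDiffOn_Icc zero_lt_one).inter ho
    have hmaps : ∀ τ ∈ Set.Icc (0 : ℝ) 1 ∩ o, y + τ • (v, (0 : E)) ∈ T := fun τ hτ => by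
      rw [← hχline ⟨τ, hτ.1⟩ hτ.2]
      exact χ.map_source (hsource (⟨τ, hτ.1⟩, z.2) hτ.2 hz2)
    have h1 := hg.iteratedDerivWithin_comp_line hTu hs y (v, 0) hmaps k (t := z.1) ⟨z.1.2, hz1⟩
    rw [← hχline z.1 hz1] at h1
    rw [show ((z.1, z.2) : Set.Icc (0 : ℝ) 1 × W) = z from rfl] at h1
    rw [← h1]
    -- Derivatives within `[0, 1]` and within its part covered by the chart agree.
    have hset : (Set.Icc (0 : ℝ) 1) =ᶠ[𝓝 (z.1 : ℝ)] (Set.Icc (0 : ℝ) 1 ∩ o : Set ℝ) := by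
      filter_upwards [ho.mem_nhds hz1] with τ hτ
      exact propext ⟨fun h => ⟨h, hτ⟩, fun h => h.1⟩
    have h2 : iteratedDerivWithin k (timeCurve G z.2) (Set.Icc 0 1) (z.1 : ℝ) =
        iteratedDerivWithin k (timeCurve G z.2) (Set.Icc 0 1 ∩ o) (z.1 : ℝ) := by
      rw [iteratedDerivWithin, iteratedDerivWithin, iteratedFDerivWithin_congr_set hset]
    rw [h2]
    refine iteratedDerivWithin_congr (fun τ hτ => ?_) ⟨z.1.2, hz1⟩
    rw [Function.comp_apply, ← hχline ⟨τ, hτ.1⟩ hτ.2,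
      χ.left_inv (hsource (⟨τ, hτ.1⟩, z.2) hτ.2 hz2), timeCurve, hproj τ hτ.1]
  have hev : ∀ᶠ q : C^∞⟮I', Set.Icc (0 : ℝ) 1 × W; 𝓘(ℝ, F), F⟯ × (Set.Icc (0 : ℝ) 1 × W) in
      𝓝 (G₀, z₀), (q.2.1 : ℝ) ∈ o ∧ q.2.2 ∈ (extChartAt J z₀.2).source := by
    have h1 : Continuous fun q : C^∞⟮I', Set.Icc (0 : ℝ) 1 × W; 𝓘(ℝ, F), F⟯ ×
        (Set.Icc (0 : ℝ) 1 × W) => (q.2.1 : ℝ) := by fun_prop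
    have h2 : Continuous fun q : C^∞⟮I', Set.Icc (0 : ℝ) 1 × W; 𝓘(ℝ, F), F⟯ ×
        (Set.Icc (0 : ℝ) 1 × W) => q.2.2 := by fun_prop
    exact (h1.continuousAt.eventually (ho.mem_nhds hto)).and
      (h2.continuousAt.eventually (extChartAt_source_mem_nhds z₀.2))
  have hχz : Tendsto (fun q : C^∞⟮I', Set.Icc (0 : ℝ) 1 × W; 𝓘(ℝ, F), F⟯ ×
      (Set.Icc (0 : ℝ) 1 × W) => χ q.2) (𝓝 (G₀, z₀)) (𝓝[T] (χ z₀)) := by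
    refine tendsto_nhdsWithin_iff.2 ⟨?_, ?_⟩
    · exact (continuousAt_extChartAt (I := I') z₀).tendsto.comp continuousAt_snd
    · filter_upwards [hev] with q hq
      exact χ.map_source (hsource q.2 hq.1 hq.2)
  have hlim := ContMDiffMap.tendsto_iteratedFDerivWithin_extend hatlas k
    (G := fun q : C^∞⟮I', Set.Icc (0 : ℝ) 1 × W; 𝓘(ℝ, F), F⟯ × (Set.Icc (0 : ℝ) 1 × W) => q.1)
    (continuousAt_fst (p := (G₀, z₀))) (mem_extChartAt_target (I := I') z₀) hχz
  have hlim' := ((ContinuousMultilinearMap.apply ℝ (fun _ : Fin k => EuclideanSpace ℝ (Fin 1) × E)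
    F (fun _ => (v, 0))).continuous.tendsto _).comp hlim
  have h0 := hkey G₀ z₀ hto (mem_extChartAt_source z₀.2)
  change Tendsto _ _ (𝓝 (iteratedDerivWithin k (timeCurve G₀ z₀.2) (Set.Icc 0 1) (z₀.1 : ℝ)))
  rw [h0]
  refine hlim'.congr' ?_
  filter_upwards [hev] with q hq
  exact (hkey q.1 q.2 hq.1 hq.2).symm

end Time

/-! ### Maps without zeros of infinite order -/

section Main

open Filter Topology MeasureTheory

variable {E : Type*} [NormedAddCommGroup E] [NormedSpace ℝ E]
  {H : Type*} [TopologicalSpace H] {J : ModelWithCorners ℝ E H}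
  {W : Type*} [TopologicalSpace W] [ChartedSpace H W] {n : ℕ}

lemma iteratedDerivWithin_euclidean_apply {s : Set ℝ} (hs : UniqueDiffOn ℝ s) {t : ℝ} (ht : t ∈ s)
    {c : ℝ → EuclideanSpace ℝ (Fin n)} (hc : ContDiffOn ℝ ∞ c s) (k : ℕ) (j : Fin n) :
    iteratedDerivWithin k (fun τ => c τ j) s t = iteratedDerivWithin k c s t j := by
  have h := ContinuousLinearMap.iteratedFDerivWithin_comp_left (i := k)
    (EuclideanSpace.proj j : EuclideanSpace ℝ (Fin n) →L[ℝ] ℝ) (hc t ht) hs ht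
    (by exact_mod_cast le_top)
  exact congrArg (fun m => m fun _ => (1 : ℝ)) h

variable (J W) in
/-- The smooth maps `G` for which no `P ∘ G (·, u)` has a zero of infinite order. -/
def finiteOrderMaps (P : MvPolynomial (Fin n) ℝ) :
    Set C^∞⟮(𝓡∂ 1).prod J, Set.Icc (0 : ℝ) 1 × W;
      𝓘(ℝ, EuclideanSpace ℝ (Fin n)), EuclideanSpace ℝ (Fin n)⟯ :=
  {G | ∀ z : Set.Icc (0 : ℝ) 1 × W, ∃ k, iteratedDerivWithin k
    (fun s => MvPolynomial.eval (fun i => timeCurve G z.2 s i) P) (Set.Icc 0 1) (z.1 : ℝ) ≠ 0}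

lemma finite_preimage_of_mem_finiteOrderMaps [IsManifold J ∞ W] {P : MvPolynomial (Fin n) ℝ}
    {G : C^∞⟮(𝓡∂ 1).prod J, Set.Icc (0 : ℝ) 1 × W;
      𝓘(ℝ, EuclideanSpace ℝ (Fin n)), EuclideanSpace ℝ (Fin n)⟯}
    (hG : G ∈ finiteOrderMaps J W P) (u : W) :
    ((fun t => G (t, u)) ⁻¹' polynomialZeroSet P).Finite := by
  have hf := ContDiffOn.mvPolynomial_eval (contDiffOn_euclidean.1 (contDiffOn_timeCurve G u)) P
  have hfin := finite_zeros_of_iteratedDerivWithin_ne_zero (convex_Icc 0 1) isCompact_Icc hf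
    fun t ht => hG (⟨t, ht⟩, u)
  refine (hfin.preimage Subtype.val_injective.injOn).subset fun t ht => ⟨t.2, ?_⟩
  simpa [timeCurve, polynomialZeroSet] using ht

/-- Openness: the Taylor coefficients of `P ∘ G (·, u)` depend continuously on `(G, t, u)`, so the
pairs of a map and a zero of infinite order form a closed set, and so does its projection along
the compact manifold. -/
lemma isOpen_finiteOrderMaps [FiniteDimensional ℝ E] [IsManifold J ∞ W] [CompactSpace W]
    (P : MvPolynomial (Fin n) ℝ) : IsOpen (finiteOrderMaps J W P) := by
  set I := Set.Icc (0 : ℝ) 1 with hI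
  have hIu : UniqueDiffOn ℝ I := uniqueDiffOn_Icc zero_lt_one
  have hcont : ∀ k, Continuous fun q : C^∞⟮(𝓡∂ 1).prod J, I × W;
      𝓘(ℝ, EuclideanSpace ℝ (Fin n)), EuclideanSpace ℝ (Fin n)⟯ × (I × W) =>
      PowerSeries.coeff k (taylorSeriesWithin
        (fun s => MvPolynomial.eval (fun i => timeCurve q.1 q.2.2 s i) P) I (q.2.1 : ℝ)) := by
    intro k
    have hcomp : ∀ q : C^∞⟮(𝓡∂ 1).prod J, I × W;
        𝓘(ℝ, EuclideanSpace ℝ (Fin n)), EuclideanSpace ℝ (Fin n)⟯ × (I × W),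
        taylorSeriesWithin (fun s => MvPolynomial.eval (fun i => timeCurve q.1 q.2.2 s i) P) I
          (q.2.1 : ℝ) = MvPolynomial.aeval (fun j => taylorSeriesWithin
            (fun s => timeCurve q.1 q.2.2 s j) I (q.2.1 : ℝ)) P := fun q =>
      taylorSeriesWithin_mvPolynomial_eval hIu q.2.1.2
        (contDiffOn_euclidean.1 (contDiffOn_timeCurve q.1 q.2.2)) P
    simp only [hcomp]
    refine continuous_iff_continuousAt.2 fun q₀ =>
      P.tendsto_coeff_aeval_powerSeries (fun j i => ?_) k
    simp only [coeff_taylorSeriesWithin]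
    have h1 : ∀ q : C^∞⟮(𝓡∂ 1).prod J, I × W;
        𝓘(ℝ, EuclideanSpace ℝ (Fin n)), EuclideanSpace ℝ (Fin n)⟯ × (I × W),
        iteratedDerivWithin i (fun s => timeCurve q.1 q.2.2 s j) I (q.2.1 : ℝ) =
          iteratedDerivWithin i (timeCurve q.1 q.2.2) I (q.2.1 : ℝ) j := fun q =>
      iteratedDerivWithin_euclidean_apply hIu q.2.1.2 (contDiffOn_timeCurve q.1 q.2.2) i j
    simp only [h1]
    have h2 := continuous_iteratedDerivWithin_timeCurve (J := J) (W := W)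
      (F := EuclideanSpace ℝ (Fin n)) i
    have h3 := (EuclideanSpace.proj j : EuclideanSpace ℝ (Fin n) →L[ℝ] ℝ).continuous.comp h2
    exact (h3.div_const (i.factorial : ℝ)).tendsto q₀
  set Z : Set (C^∞⟮(𝓡∂ 1).prod J, I × W;
      𝓘(ℝ, EuclideanSpace ℝ (Fin n)), EuclideanSpace ℝ (Fin n)⟯ × (I × W)) :=
    {q | ∀ k, PowerSeries.coeff k (taylorSeriesWithin
        (fun s => MvPolynomial.eval (fun i => timeCurve q.1 q.2.2 s i) P) I (q.2.1 : ℝ)) = 0} with hZ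
  have hZc : IsClosed Z := by
    simp only [hZ, Set.ofPred_forall]
    exact isClosed_iInter fun k => isClosed_eq (hcont k) continuous_const
  have hproj : (finiteOrderMaps J W P)ᶜ = Prod.fst '' Z := by
    ext G
    simp only [finiteOrderMaps, Set.mem_compl_iff, Set.mem_ofPred_eq, not_forall, not_exists,
      not_not, hZ, coeff_taylorSeriesWithin, div_eq_zero_iff, Nat.cast_eq_zero,
      Nat.factorial_ne_zero, or_false, Set.mem_image, Prod.exists, exists_and_right,
      exists_eq_right]
    exact Iff.rfl
  rw [← isClosed_compl_iff, hproj]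
  exact isClosedMap_fst_of_compactSpace Z hZc

/-- The map `(t, u) ↦ t ^ l • e`. -/
noncomputable def timePower (J : ModelWithCorners ℝ E H) (W : Type*) [TopologicalSpace W]
    [ChartedSpace H W] (e : Fin n → ℝ) (l : ℕ) :
    C^∞⟮(𝓡∂ 1).prod J, Set.Icc (0 : ℝ) 1 × W;
      𝓘(ℝ, EuclideanSpace ℝ (Fin n)), EuclideanSpace ℝ (Fin n)⟯ :=
  ⟨fun z => (z.1 : ℝ) ^ l • WithLp.toLp 2 e, by
    have h1 : ContMDiff ((𝓡∂ 1).prod J) 𝓘(ℝ, ℝ) ∞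
        fun z : Set.Icc (0 : ℝ) 1 × W => (z.1 : ℝ) :=
      contMDiff_subtypeVal_Icc.comp contMDiff_fst
    have h2 : ContDiff ℝ ∞ fun t : ℝ => t ^ l • (WithLp.toLp 2 e : EuclideanSpace ℝ (Fin n)) := by
      fun_prop
    exact h2.contMDiff.comp h1⟩

lemma timeCurve_add_sum_timePower {N : ℕ} (e : Fin n → ℝ) (a : Fin N → ℝ)
    (G : C^∞⟮(𝓡∂ 1).prod J, Set.Icc (0 : ℝ) 1 × W;
      𝓘(ℝ, EuclideanSpace ℝ (Fin n)), EuclideanSpace ℝ (Fin n)⟯) (u : W) {s : ℝ}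
    (hs : s ∈ Set.Icc (0 : ℝ) 1) (i : Fin n) :
    timeCurve (G + ∑ l : Fin N, a l • timePower J W e l) u s i =
      timeCurve G u s i + (∑ l, a l * s ^ (l : ℕ)) * e i := by
  have h2 : ((∑ l : Fin N, a l • timePower J W e l : C^∞⟮(𝓡∂ 1).prod J, Set.Icc (0 : ℝ) 1 × W;
      𝓘(ℝ, EuclideanSpace ℝ (Fin n)), EuclideanSpace ℝ (Fin n)⟯) :
      Set.Icc (0 : ℝ) 1 × W → EuclideanSpace ℝ (Fin n)) =
        ∑ l : Fin N, a l • ⇑(timePower J W e l) :=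
    map_sum (ContMDiffMap.coeFnAddMonoidHom (I := (𝓡∂ 1).prod J)
      (I' := 𝓘(ℝ, EuclideanSpace ℝ (Fin n))) (N := Set.Icc (0 : ℝ) 1 × W)
      (G := EuclideanSpace ℝ (Fin n)) (n := ∞)) (fun l : Fin N => a l • timePower J W e l)
      Finset.univ
  have h3 : ∀ (l : ℕ) (z : Set.Icc (0 : ℝ) 1 × W),
      timePower J W e l z = (z.1 : ℝ) ^ l • WithLp.toLp 2 e := fun l z => rfl
  simp only [timeCurve, ContMDiffMap.coe_add, h2, Pi.add_apply, Finset.sum_apply, Pi.smul_apply,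
    h3, Set.projIcc_of_mem zero_le_one hs, PiLp.add_apply, Finset.sum_mul]
  simp [mul_assoc]

/-- Density: almost every small perturbation of a given map by a polynomial in time lies in the
set. -/
lemma dense_finiteOrderMaps [FiniteDimensional ℝ E] [IsManifold J ∞ W] [CompactSpace W]
    {P : MvPolynomial (Fin n) ℝ} (hP : P ≠ 0) : Dense (finiteOrderMaps J W P) := by
  by_cases hD : P.totalDegree = 0
  · -- A nonzero constant has no zeros at all.
    rw [MvPolynomial.totalDegree_eq_zero_iff_eq_C] at hD
    have hc : P.coeff 0 ≠ 0 := fun h => hP (by rw [hD, h, map_zero])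
    have huniv : finiteOrderMaps J W P = Set.univ := by
      refine Set.eq_univ_of_forall fun G z => ⟨0, ?_⟩
      rw [iteratedDerivWithin_zero, hD, MvPolynomial.eval_C]
      exact hc
    rw [huniv]
    exact dense_univ
  obtain ⟨e, he⟩ := MvPolynomial.exists_eval_homogeneousComponent_ne_zero hP
  set N := sparseOrder P.totalDegree (P.totalDegree * (Module.finrank ℝ E + 1) + 1) with hN
  refine dense_iff_inter_open.2 fun O hO ⟨G, hG⟩ => ?_
  set Φ : (Fin N → ℝ) → C^∞⟮(𝓡∂ 1).prod J, Set.Icc (0 : ℝ) 1 × W;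
      𝓘(ℝ, EuclideanSpace ℝ (Fin n)), EuclideanSpace ℝ (Fin n)⟯ :=
    fun a => G + ∑ l : Fin N, a l • timePower J W e l with hΦ
  have hΦc : Continuous Φ := G.continuous_add_sum_smul fun l : Fin N => timePower J W e l
  -- Finitely many compact convex coordinate patches cover `W`.
  have hpatch : ∀ u : W, ∃ K ⊆ (extChartAt J u).target, IsCompact K ∧ Convex ℝ K ∧
      K ∈ 𝓝[(extChartAt J u).target] (extChartAt J u u) := fun u =>
    OpenPartialHomeomorph.exists_isCompact_convex_subset_extend_target _ (mem_extChartAt_target u)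
  choose K hKT hK hKc hKnhds using hpatch
  have hnhds : ∀ u : W, {w | w ∈ (extChartAt J u).source ∧ extChartAt J u w ∈ K u} ∈ 𝓝 u := by
    intro u
    have h1 : Tendsto (extChartAt J u) (𝓝 u) (𝓝[(extChartAt J u).target] (extChartAt J u u)) :=
      tendsto_nhdsWithin_iff.2 ⟨continuousAt_extChartAt u, by
        filter_upwards [extChartAt_source_mem_nhds (I := J) u] with w hw
        exact (extChartAt J u).map_source hw⟩
    exact inter_mem (extChartAt_source_mem_nhds u) (h1 (hKnhds u))
  obtain ⟨A, -, hA⟩ := isCompact_univ.elim_nhds_subcover _ fun u _ => hnhds u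
  set bad : W → Set (Fin N → ℝ) := fun u => {a | a ∈ Set.Icc (-1 : Fin N → ℝ) 1 ∧
    ∃ t ∈ Set.Icc (0 : ℝ) 1, ∃ x ∈ K u, ∀ k, iteratedDerivWithin k
      (fun s => MvPolynomial.eval (perturbedFamily
        (fun z : ℝ × E => timeCurve G ((extChartAt J u).symm z.2) z.1) e a x s) P)
      (Set.Icc 0 1) t = 0} with hbad
  have hbad0 : ∀ u, volume (bad u) = 0 := fun u =>
    P.volume_flat_parameters_eq_zero hD e he
      (OpenPartialHomeomorph.uniqueDiffOn_extend_target (chartAt H u)) (hKT u) (hK u) (hKc u)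
      (contDiffOn_timeCurve_extChartAt_symm G u) le_rfl
  have hgood : ∀ a ∈ Set.Icc (-1 : Fin N → ℝ) 1, a ∉ ⋃ u ∈ A, bad u →
      Φ a ∈ finiteOrderMaps J W P := by
    intro a ha hnot z
    by_contra! hflat
    obtain ⟨u, hu, hz⟩ := Set.mem_iUnion₂.1 (hA (Set.mem_univ z.2))
    refine hnot (Set.mem_iUnion₂.2 ⟨u, hu, ha, z.1, z.1.2, _, hz.2, fun k => ?_⟩)
    refine (iteratedDerivWithin_congr (fun s hs => ?_) z.1.2).trans (hflat k)
    congr 2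
    ext i
    rw [hΦ, timeCurve_add_sum_timePower e a G z.2 hs, perturbedFamily,
      (extChartAt J u).left_inv hz.1]
  have hnull : volume (⋃ u ∈ A, bad u) = 0 :=
    (measure_biUnion_null_iff A.countable_toSet).2 fun u _ => hbad0 u
  have hV : IsOpen (Φ ⁻¹' O ∩ Metric.ball 0 1) := (hO.preimage hΦc).inter Metric.isOpen_ball
  have hV0 : (0 : Fin N → ℝ) ∈ Φ ⁻¹' O ∩ Metric.ball 0 1 :=
    ⟨by simpa [hΦ] using hG, Metric.mem_ball_self one_pos⟩
  have hpos := hV.measure_pos volume ⟨0, hV0⟩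
  obtain ⟨a, haV, hab⟩ : ((Φ ⁻¹' O ∩ Metric.ball 0 1) \ ⋃ u ∈ A, bad u).Nonempty := by
    rw [Set.nonempty_iff_ne_empty, Ne, Set.sdiff_eq_empty]
    exact fun h => hpos.ne' (measure_mono_null h hnull)
  refine ⟨Φ a, haV.1, hgood a ?_ hab⟩
  have hnorm : ‖a‖ ≤ 1 := (mem_ball_zero_iff.1 haV.2).le
  have hcoord : ∀ l, |a l| ≤ 1 := fun l => (norm_le_pi_norm a l).trans hnorm
  exact ⟨fun l => (abs_le.1 (hcoord l)).1, fun l => (abs_le.1 (hcoord l)).2⟩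

end Main

theorem mainTheorem11 {n : ℕ} (P : MvPolynomial (Fin n) ℝ) (hP : P ≠ 0)
    {E : Type*} [NormedAddCommGroup E] [NormedSpace ℝ E] [FiniteDimensional ℝ E]
    {H : Type*} [TopologicalSpace H] (J : ModelWithCorners ℝ E H)
    {W : Type*} [TopologicalSpace W] [ChartedSpace H W] [IsManifold J ∞ W]
    [T2Space W] [CompactSpace W] :
    ∃ U : Set C^∞⟮(𝓡∂ 1).prod J, Set.Icc (0 : ℝ) 1 × W;
        𝓘(ℝ, EuclideanSpace ℝ (Fin n)), EuclideanSpace ℝ (Fin n)⟯,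
      IsOpen U ∧ Dense U ∧
        ∀ G ∈ U, ∀ u : W, ((fun t => G (t, u)) ⁻¹' polynomialZeroSet P).Finite :=
  ⟨finiteOrderMaps J W P, isOpen_finiteOrderMaps P, dense_finiteOrderMaps hP,
    fun _ hG u => finite_preimage_of_mem_finiteOrderMaps hG u⟩
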